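/- Setting. Let $\mathcal X$ be a measurable space, $\mathcal F$ a class of measurable hypotheses $f:\mathcal X\to\{0,1\}$ of VC dimension $d$, and let $D_1,\dots,D_k$ ($k\ge 1$) be arbitrary probability distributions on $\mathcal X\times\{0,1\}$. Write $\mathrm{err}_D(f)=\Pr_{(x,y)\sim D}[f(x)\ne y]$, let $\mathrm{err}_S(f)$ be the fraction of mistakes of $f$ on a finite sample $S$, and let $\mathrm{OPT}=\inf_{f\in\mathcal F}\max_{i}\mathrm{err}_{D_i}(f)$ (not assumed to be $0$). Algorithm NR2, with parameters $\epsilon,\delta\in(0,1)$, $5\epsilon/4<\alpha<1$ and constants $C_1,C_2>0$. Put $\alpha'=\alpha/40$, $\epsilon'=\epsilon/64$, $t=2\lceil \ln(4k/\delta)/\alpha'^3\rceil$, $\delta'=\delta/(4t)$ and $w_i^{(0)}=1$ for all $i$. In round $r=1,\dots,t$: draw a sample $S^{(r)}$ of size $\big\lceil \frac{C_1}{\alpha'\epsilon'}\big(d\ln\frac1{\epsilon'}+\ln\frac1{\delta'}\big)\big\rceil$ from the mixture $\frac{1}{\Phi^{(r-1)}}\sum_i w_i^{(r-1)}D_i$,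 where $\Phi^{(r-1)}=\sum_i w_i^{(r-1)}$; let $f^{(r)}=\mathcal O_{\mathcal F}(S^{(r)})$; for each player $i$ draw a test sample $T_i$ of size $\big\lceil\frac{C_2}{\alpha'\epsilon'}\ln\frac1{\alpha'}\big\rceil$ from $D_i$, and set $w_i^{(r)}=w_i^{(r-1)}(1+s_i^{(r)})$ with $$s_i^{(r)}=\min\Big(\frac{\mathrm{err}_{T_i}(f^{(r)})\,\alpha'^2}{(1+3\alpha')\,\mathrm{err}_{S^{(r)}}(f^{(r)})+3\epsilon'},\ \alpha'\Big).$$ All draws of a round are independent given the past. The output $f_{\mathrm{NR2}}$ is the majority vote of $f^{(1)},\dots,f^{(t)}$ (ties are resolved to the label $0$). Here $\mathcal O_{\mathcal F}$ is any (measurable) empirical risk minimization oracle with slack $\epsilon'$: $\mathcal O_{\mathcal F}(S)\in\mathcal F$ and $\mathrm{err}_S(\mathcal O_{\mathcal F}(S))\le\inf_{f\in\mathcal F}\mathrm{err}_S(f)+\epsilon'$ for every sample $S$. Theorem. There are universal constants $C_1,C_2,C>0$ such that for all $k\ge1$, $d\ge 0$, all $\epsilon,\delta\in(0,1)$ and all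 $\alpha$ with $5\epsilon/4<\alpha<1$, the following holds. (1) For all $\mathcal X,\mathcal F,D_1,\dots,D_k,\mathcal O_{\mathcal F}$ as above, with probability at least $1-\delta$ over the samples, $\mathrm{err}_{D_i}(f_{\mathrm{NR2}})\le(2+\alpha)\,\mathrm{OPT}+\epsilon$ for all $i\in\{1,\dots,k\}$ simultaneously. (2) The total number $m$ of samples drawn by the algorithm satisfies $$m\le \frac{C}{\alpha^4\epsilon}\ln\Big(\frac{2k}{\delta}\Big)\Big(d\ln\frac1\epsilon+k\ln\frac2\alpha+\ln\frac1\delta\Big),$$ and if $\alpha\le 1/2$ and $2\delta\le k$ (the latter is automatic for $k\ge2$), then also $$m\le \frac{C}{\alpha^4\epsilon}\ln\Big(\frac{k}{\delta}\Big)\Big(d\ln\frac1\epsilon+k\ln\frac1\alpha+\ln\frac1\delta\Big).$$ -/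

import Mathlib

open MeasureTheory

noncomputable section

namespace CollabPAC

/-- A finite set `A` of instances is shattered by the class `F`: every labelling of `A` is
realized by a hypothesis of `F`. -/
def Shatters {X : Type*} (F : Set (X → Bool)) (A : Finset X) : Prop :=
  ∀ g : X → Bool, ∃ f ∈ F, ∀ x ∈ A, f x = g x

/-- The VC dimension of a class of hypotheses: the supremum of the sizes of its shattered sets. -/
def vcDim {X : Type*} (F : Set (X → Bool)) : ℕ∞ :=
  ⨆ A : {A : Finset X // Shatters F A}, (A.1.card : ℕ∞)

/-- The error `Pr_{(x,y) ∼ D} [f x ≠ y]` of a classifier on a distribution. -/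
def err {X : Type*} [MeasurableSpace X] (D : Measure (X × Bool)) (f : X → Bool) : ℝ :=
  D.real {p | f p.1 ≠ p.2}

/-- The empirical error of a classifier on a sample of size `n`: the fraction of mistakes. -/
def empErr {X : Type*} {n : ℕ} (S : Fin n → X × Bool) (f : X → Bool) : ℝ :=
  ((Finset.univ.filter fun j => f (S j).1 ≠ (S j).2).card : ℝ) / n

/-- `OPT = inf_{f ∈ F} max_i err_{D_i}(f)`. -/
def OPT {X : Type*} [MeasurableSpace X] {k : ℕ} (F : Set (X → Bool))
    (D : Fin k → Measure (X × Bool)) : ℝ :=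
  ⨅ f : F, ⨆ i, err (D i) f.1

/-- `O` is an empirical error minimization oracle for `F` with slack `τ`: on every sample it
returns a member of `F` whose empirical error is within `τ` of the infimum over `F`.
As always for a learning algorithm that is fed random samples, the label that the returned
hypothesis gives to `x` depends measurably on the sample and `x`. -/
structure IsOracle {X : Type*} [MeasurableSpace X] (F : Set (X → Bool)) (τ : ℝ)
    (O : (n : ℕ) → (Fin n → X × Bool) → X → Bool) : Prop where
  mem : ∀ n S, O n S ∈ F
  empErr_le : ∀ n S, empErr S (O n S) ≤ (⨅ f : F, empErr S f.1) + τ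
  measurable : ∀ n, Measurable fun p : (Fin n → X × Bool) × X => O n p.1 p.2

/-- The majority vote of `t` classifiers (ties give the label `false`). -/
def maj {X : Type*} {t : ℕ} (f : Fin t → X → Bool) (x : X) : Bool :=
  decide (t < 2 * (Finset.univ.filter fun r => f r x = true).card)

/-- The samples drawn in one round: a sample `S` of size `m` from the mixture, and for each of
the `k` players a test sample `T i` of size `n`. -/
abbrev Round (X : Type*) (k m n : ℕ) : Type _ :=
  (Fin m → X × Bool) × (Fin k → Fin n → X × Bool)

section Algorithm

variable {X : Type*} {k m n : ℕ}

/-- The classifier that is learned in a round. -/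
def roundClassifier (O : (n : ℕ) → (Fin n → X × Bool) → X → Bool) (R : Round X k m n) :
    X → Bool :=
  O m R.1

/-- The increment `s_i` of a round, for the parameters `a = α'` and `e = ε'`. -/
def increment (O : (n : ℕ) → (Fin n → X × Bool) → X → Bool) (a e : ℝ) (R : Round X k m n)
    (i : Fin k) : ℝ :=
  min (empErr (R.2 i) (roundClassifier O R) * a ^ 2 /
    ((1 + 3 * a) * empErr R.1 (roundClassifier O R) + 3 * e)) a

/-- The weight `w_i` after the rounds `h`: it starts at `1` and is multiplied by `1 + s_i` in each
round. -/
def weight (O : (n : ℕ) → (Fin n → X × Bool) → X → Bool) (a e : ℝ) {r : ℕ}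
    (h : Fin r → Round X k m n) (i : Fin k) : ℝ :=
  ∏ q, (1 + increment O a e (h q) i)

/-- The mixture `(1/Φ) ∑ i, w_i D_i`, where `Φ = ∑ i, w_i`. -/
def mixture [MeasurableSpace X] (D : Fin k → Measure (X × Bool)) (w : Fin k → ℝ) :
    Measure (X × Bool) :=
  ∑ i, ENNReal.ofReal (w i / ∑ j, w j) • D i

/-- The law of the samples of a round that starts with the weights `w`: all draws are independent,
those of the first sample from the mixture, those of the `i`-th test sample from `D i`. -/
def roundLaw [MeasurableSpace X] (m n : ℕ) (D : Fin k → Measure (X × Bool)) (w : Fin k → ℝ) :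
    Measure (Round X k m n) :=
  (Measure.pi fun _ : Fin m => mixture D w).prod
    (Measure.pi fun i : Fin k => Measure.pi fun _ : Fin n => D i)

/-- The law of all samples drawn during the first `r` rounds. -/
def runLaw [MeasurableSpace X] (O : (n : ℕ) → (Fin n → X × Bool) → X → Bool) (a e : ℝ)
    (m n : ℕ) (D : Fin k → Measure (X × Bool)) : (r : ℕ) → Measure (Fin r → Round X k m n)
  | 0 => Measure.dirac Fin.elim0
  | r + 1 => (runLaw O a e m n D r).bind fun h =>
      (roundLaw m n D (weight O a e h)).map fun R => (Fin.snoc h R : Fin (r + 1) → Round X k m n)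

end Algorithm

/-- The number of rounds `t = 2 ⌈ln (4k/δ) / α'³⌉`, `α' = α/40`. -/
def numRounds (k : ℕ) (α δ : ℝ) : ℕ :=
  2 * ⌈Real.log (4 * k / δ) / (α / 40) ^ 3⌉₊

/-- The size `C/(α'ε') (d ln (1/ε') + ln (1/δ'))` of the sample that is drawn from the mixture in
each round, `α' = α/40`, `ε' = ε/64`, `δ' = δ/(4t)`. -/
def trainSize (C : ℝ) (k d : ℕ) (ε δ α : ℝ) : ℕ :=
  ⌈C / ((α / 40) * (ε / 64)) *
    (d * Real.log (1 / (ε / 64)) + Real.log (1 / (δ / (4 * numRounds k α δ))))⌉₊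

/-- The size `C/(α'ε') ln (1/α')` of the test sample that is drawn from each player in each round,
`α' = α/40`, `ε' = ε/64`. -/
def testSize (C : ℝ) (ε α : ℝ) : ℕ :=
  ⌈C / ((α / 40) * (ε / 64)) * Real.log (1 / (α / 40))⌉₊

/-- The samples drawn in a complete run of Algorithm NR2 (with constants `C₁`, `C₂` in the sample
sizes) for `k` players. -/
abbrev NR2Run (X : Type*) (C₁ C₂ : ℝ) (k d : ℕ) (ε δ α : ℝ) : Type _ :=
  Fin (numRounds k α δ) → Round X k (trainSize C₁ k d ε δ α) (testSize C₂ ε α)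

/-- The law of the samples drawn in a complete run of Algorithm NR2. -/
def nr2Law {X : Type*} [MeasurableSpace X] (C₁ C₂ : ℝ) (d : ℕ) (ε δ α : ℝ)
    (O : (n : ℕ) → (Fin n → X × Bool) → X → Bool) {k : ℕ} (D : Fin k → Measure (X × Bool)) :
    Measure (NR2Run X C₁ C₂ k d ε δ α) :=
  runLaw O (α / 40) (ε / 64) _ _ D _

/-- The classifier that Algorithm NR2 returns: the majority vote over the classifiers of all
rounds. -/
def nr2Output {X : Type*} {C₁ C₂ : ℝ} {k d : ℕ} {ε δ α : ℝ}
    (O : (n : ℕ) → (Fin n → X × Bool) → X → Bool) (h : NR2Run X C₁ C₂ k d ε δ α) : X → Bool :=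
  maj fun r => roundClassifier O (h r)

/-- The number of labelled examples drawn in a run of Algorithm NR2: in each of the rounds, one
sample from the mixture and one test sample from each of the `k` players. -/
def nr2SampleCount (C₁ C₂ : ℝ) (k d : ℕ) (ε δ α : ℝ) : ℕ :=
  numRounds k α δ * (trainSize C₁ k d ε δ α + k * testSize C₂ ε α)

end CollabPAC

end

/-! Write `a = α/40`, `e = ε/64`, and let `B` be the denominator of the increments of a round. The
proof is a multiplicative-weights argument run in expectation, so no player's test error has to
concentrate in any single round.

Call a training sample good if the learned classifier has error at most `B` on the current mixture
and empirical error at most `(1 + a) OPT + 4e`. Symmetrization and Sauer–Shelah give the first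
property in relative form (`IsOracle.pi_err_gt_le`). For the second, the oracle is compared with one
fixed near-optimal hypothesis (`pi_empErr_gt_le`). With failure probability `δ/(4t)` per round, all
rounds are good up to `δ/4`.

Upper bound: in a good round the weighted average of `err_{D_i} / B` is at most `1`, so the total
weight grows in expectation by a factor of at most `1 + a²`. By Markov it ends below `(4k/δ)(1 +
a²)^t` (`lintegral_weight_le`).

Lower bound: let `gain` be a lower bound for the conditional mean of the increment `s_i`, roughly
`min(a² err_{D_i} / B, a)`. Since `s_i ≤ a`, the product of the factors `exp((1 - a) gain) / (1 +
s_i)` has mean at most `1`. By Markov and a union bound over the players, no weight is smaller than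
`exp((1 - a) ∑ gain)` by more than a factor `4k/δ` (`lintegral_gainRatio_le`).

Together `(1 - a) ∑ gain ≤ 2 ln(4k/δ) + a² t ≤ a² t (1 + a)`, by the choice of `t`. Rounds in which
the gain is truncated contribute about `a` each, so they are an `O(a)` fraction and can be
discarded. On the others the average error is at most about `max B`. A mistake of the majority needs
`t/2` mistaken voters, which costs the factor `2`, so the error is at most `(2 + O(a)) OPT + O(e)`
(`vote_bound`). -/

noncomputable section

namespace CollabPAC

/-! ### Sauer–Shelah: counting the labellings of finitely many points -/

/-- The labellings of the points `x` that are realized by `F`. -/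
def patterns {X ι : Type*} [Fintype ι] (F : Set (X → Bool)) (x : ι → X) : Finset (ι → Bool) :=
  (Set.toFinite {p | ∃ f ∈ F, ∀ i, p i = f (x i)}).toFinset

theorem mem_patterns {X ι : Type*} [Fintype ι] {F : Set (X → Bool)} {x : ι → X} {p : ι → Bool} :
    p ∈ patterns F x ↔ ∃ f ∈ F, ∀ i, p i = f (x i) := by
  simp [patterns]

theorem Shatters.card_le {X : Type*} {F : Set (X → Bool)} {A : Finset X} (h : Shatters F A) {d : ℕ}
    (hd : vcDim F ≤ d) : A.card ≤ d := by
  have h1 : (A.card : ℕ∞) ≤ vcDim F :=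
    le_iSup (fun A : {A : Finset X // Shatters F A} => (A.1.card : ℕ∞)) ⟨A, h⟩
  exact_mod_cast h1.trans hd

/-- The Sauer–Shelah lemma for the labellings of a finite family of points. -/
theorem card_patterns_le {X ι : Type*} [Fintype ι] {F : Set (X → Bool)} {d : ℕ}
    (hd : vcDim F ≤ d) (x : ι → X) :
    (patterns F x).card ≤ ∑ i ∈ Finset.Iic d, (Fintype.card ι).choose i := by
  classical
  let T : (ι → Bool) → Finset ι := fun p => Finset.univ.filter fun i => p i = true
  have hT : Function.Injective T := by
    intro p q hpq
    funext i
    have := congrArg (fun s => i ∈ s) hpq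
    simp only [T, Finset.mem_filter, Finset.mem_univ, true_and, eq_iff_iff] at this
    exact Bool.eq_iff_iff.2 this
  set A := (patterns F x).image T with hA
  have h1 : (patterns F x).card = A.card := (Finset.card_image_of_injective _ hT).symm
  have hvc : A.vcDim ≤ d := by
    refine Finset.sup_le fun s hs => ?_
    rw [Finset.mem_shatterer] at hs
    have key : ∀ t ⊆ s, ∃ f ∈ F, ∀ i ∈ s, (f (x i) = true ↔ i ∈ t) := by
      intro t ht
      obtain ⟨u, hu, hut⟩ := hs ht
      obtain ⟨p, hp, rfl⟩ := Finset.mem_image.1 hu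
      obtain ⟨f, hf, hpf⟩ := mem_patterns.1 hp
      refine ⟨f, hf, fun i hi => ?_⟩
      rw [← hut, Finset.mem_inter, ← hpf i]
      simp [T, hi]
    -- The points may repeat, but a shattered index set cannot contain two indices of one point: the
    -- labelling that cuts out `{i}` would separate them.
    have hinj : Set.InjOn x s := by
      intro i hi j hj hij
      obtain ⟨f, -, hf⟩ := key {i} (by simpa using hi)
      have h1 := (hf i hi).2 (by simp)
      rw [hij] at h1
      have := (hf j hj).1 h1
      exact (Finset.mem_singleton.1 this).symm
    have hsh : Shatters F (s.image x) := by
      intro g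
      obtain ⟨f, hf, hfs⟩ := key (s.filter fun i => g (x i) = true) (Finset.filter_subset _ _)
      refine ⟨f, hf, fun y hy => ?_⟩
      obtain ⟨i, hi, rfl⟩ := Finset.mem_image.1 hy
      have := hfs i hi
      simp only [Finset.mem_filter, hi, true_and] at this
      exact Bool.eq_iff_iff.2 this
    have := hsh.card_le hd
    rwa [Finset.card_image_of_injOn hinj] at this
  rw [h1]
  refine (Finset.card_le_card_shatterer A).trans (Finset.card_shatterer_le_sum_vcDim.trans ?_)
  exact Finset.sum_le_sum_of_subset (Finset.Iic_subset_Iic.2 hvc)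

/-- Since `x ^ d ≤ x ^ i` for `i ≤ d`, the sum is at most `x ^ (-d) * (1 + x) ^ n`. Keeping `x` free
avoids any case distinction between `d` and `n`; it is later tuned so that `n * x` is a fixed
fraction of the deviation exponent. -/
theorem sum_choose_le_exp (n d : ℕ) {x : ℝ} (hx : 0 < x) (hx1 : x ≤ 1) :
    ((∑ i ∈ Finset.Iic d, n.choose i : ℕ) : ℝ) ≤ Real.exp (d * Real.log (1 / x) + n * x) := by
  have h1 : Real.exp (d * Real.log (1 / x)) = (1 / x) ^ d := by
    rw [← Real.log_pow, Real.exp_log (by positivity)]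
  have h2 : (1 + x) ^ n ≤ Real.exp (n * x) := by
    rw [Real.exp_nat_mul]
    exact pow_le_pow_left₀ (by positivity) (by linarith [Real.add_one_le_exp x]) n
  have h3 : ∑ i ∈ Finset.Iic d, x ^ i * (n.choose i : ℝ) ≤ (1 + x) ^ n := by
    rw [add_comm, add_pow]
    simp only [one_pow, mul_one]
    have : ∀ i ∈ Finset.Iic d, i ∉ Finset.Iic d ∩ Finset.range (n + 1) →
        x ^ i * (n.choose i : ℝ) = 0 := by
      intro i hi hi'
      simp only [Finset.mem_inter, hi, true_and, Finset.mem_range, not_lt] at hi'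
      rw [Nat.choose_eq_zero_of_lt (by omega)]
      simp
    rw [← Finset.sum_subset Finset.inter_subset_left this]
    exact Finset.sum_le_sum_of_subset_of_nonneg Finset.inter_subset_right
      fun i _ _ => by positivity
  have h4 : x ^ d * ∑ i ∈ Finset.Iic d, (n.choose i : ℝ) ≤
      ∑ i ∈ Finset.Iic d, x ^ i * (n.choose i : ℝ) := by
    rw [Finset.mul_sum]
    refine Finset.sum_le_sum fun i hi => ?_
    exact mul_le_mul_of_nonneg_right
      (pow_le_pow_of_le_one hx.le hx1 (Finset.mem_Iic.1 hi)) (by positivity)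
  rw [Real.exp_add, h1, one_div, inv_pow, ← div_eq_inv_mul, le_div_iff₀ (by positivity), mul_comm]
  push_cast
  linarith

/-! ### Relative tail bounds for random swaps -/

/-- The sign of a swap. -/
def swapSign (s : Bool) : ℝ := if s then -1 else 1

/-- An exponential moment bound for Rademacher sums. -/
theorem sum_exp_swapSign_le {m : ℕ} (a : ℝ) (c : Fin m → ℝ) :
    ∑ s : Fin m → Bool, Real.exp (a * ∑ j, swapSign (s j) * c j) ≤
      2 ^ m * Real.exp (a ^ 2 / 2 * ∑ j, c j ^ 2) := by
  have h1 : ∀ s : Fin m → Bool, Real.exp (a * ∑ j, swapSign (s j) * c j) =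
      ∏ j, Real.exp (a * (swapSign (s j) * c j)) := by
    intro s
    rw [Finset.mul_sum, Real.exp_sum]
  have h2 : ∑ s : Fin m → Bool, ∏ j, Real.exp (a * (swapSign (s j) * c j)) =
      ∏ j, ∑ b : Bool, Real.exp (a * (swapSign b * c j)) := by
    rw [Finset.prod_univ_sum, Fintype.piFinset_univ]
  simp only [h1, h2]
  have h3 : ∀ j, ∑ b : Bool, Real.exp (a * (swapSign b * c j)) ≤
      2 * Real.exp (a ^ 2 / 2 * c j ^ 2) := by
    intro j
    have := Real.cosh_le_exp_half_sq (a * c j)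
    rw [Real.cosh_eq] at this
    simp only [Fintype.sum_bool, swapSign]
    rw [show a ^ 2 / 2 * c j ^ 2 = (a * c j) ^ 2 / 2 by ring]
    simp only [if_true, Bool.false_eq_true, if_false, one_mul]
    rw [show a * (-1 * c j) = -(a * c j) by ring]
    linarith
  calc _ ≤ ∏ j : Fin m, 2 * Real.exp (a ^ 2 / 2 * c j ^ 2) :=
        Finset.prod_le_prod (fun j _ => by positivity) fun j _ => h3 j
    _ = _ := by
        rw [Finset.prod_mul_distrib, ← Real.exp_sum, ← Finset.mul_sum]
        simp

/-- A relative deviation bound for the number of mistakes on two halves of a sample that are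
randomly swapped pairwise: `b` and `b'` indicate the mistakes. -/
theorem card_swap_le {m : ℕ} {a u : ℝ} (ha : 0 < a) (b b' : Fin m → ℝ)
    (hb : ∀ j, b j = 0 ∨ b j = 1) (hb' : ∀ j, b' j = 0 ∨ b' j = 1) :
    ((Finset.univ.filter fun s : Fin m → Bool =>
      a / 2 * ∑ j, (b j + b' j) + u ≤ ∑ j, swapSign (s j) * (b' j - b j)).card : ℝ) ≤
      2 ^ m * Real.exp (-(a * u)) := by
  have h1 : ∀ s ∈ (Finset.univ.filter fun s : Fin m → Bool =>
      a / 2 * ∑ j, (b j + b' j) + u ≤ ∑ j, swapSign (s j) * (b' j - b j)),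
      Real.exp (a * (a / 2 * ∑ j, (b j + b' j) + u)) ≤
        Real.exp (a * ∑ j, swapSign (s j) * (b' j - b j)) := by
    intro s hs
    exact Real.exp_le_exp.2 (mul_le_mul_of_nonneg_left (Finset.mem_filter.1 hs).2 ha.le)
  have h2 := (Finset.card_nsmul_le_sum _ _ _ h1).trans
    ((Finset.sum_le_sum_of_subset_of_nonneg (Finset.filter_subset _ _)
      fun s _ _ => (Real.exp_pos _).le).trans (sum_exp_swapSign_le a fun j => b' j - b j))
  -- For indicators the variance proxy is at most the number of mistakes. The term `a / 2 * ∑ (b +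
  -- b')` of the threshold cancels it exactly, which makes the bound relative.
  have h3 : ∑ j, (b' j - b j) ^ 2 ≤ ∑ j, (b j + b' j) := by
    refine Finset.sum_le_sum fun j _ => ?_
    rcases hb j with h | h <;> rcases hb' j with h' | h' <;> rw [h, h'] <;> norm_num
  have h4 : Real.exp (a ^ 2 / 2 * ∑ j, (b' j - b j) ^ 2) ≤
      Real.exp (a ^ 2 / 2 * ∑ j, (b j + b' j)) :=
    Real.exp_le_exp.2 (mul_le_mul_of_nonneg_left h3 (by positivity))
  rw [nsmul_eq_mul] at h2
  have h5 : Real.exp (a * (a / 2 * ∑ j, (b j + b' j) + u)) =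
      Real.exp (a ^ 2 / 2 * ∑ j, (b j + b' j)) * Real.exp (a * u) := by
    rw [← Real.exp_add]; ring_nf
  rw [h5, ← mul_assoc, mul_right_comm] at h2
  rw [Real.exp_neg, ← div_eq_mul_inv, le_div_iff₀ (Real.exp_pos _)]
  have h6 := h2.trans (mul_le_mul_of_nonneg_left h4 (by positivity))
  exact le_of_mul_le_mul_right h6 (Real.exp_pos _)

/-! ### Moments and tails of empirical errors -/

/-- The indicator of a mistake. -/
def mistake {X : Type*} (f : X → Bool) (z : X × Bool) : ℝ := if f z.1 ≠ z.2 then 1 else 0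

section Mistake

variable {X : Type*}

theorem mistake_eq_zero_or_one (f : X → Bool) (z : X × Bool) :
    mistake f z = 0 ∨ mistake f z = 1 := by
  unfold mistake; split_ifs <;> simp

theorem mistake_nonneg (f : X → Bool) (z : X × Bool) : 0 ≤ mistake f z := by
  rcases mistake_eq_zero_or_one f z with h | h <;> rw [h]
  exact zero_le_one

theorem mistake_le_one (f : X → Bool) (z : X × Bool) : mistake f z ≤ 1 := by
  rcases mistake_eq_zero_or_one f z with h | h <;> rw [h]
  exact zero_le_one

theorem empErr_eq_sum {n : ℕ} (S : Fin n → X × Bool) (f : X → Bool) :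
    empErr S f = (∑ j, mistake f (S j)) / n := by
  simp [empErr, mistake, Finset.sum_ite]

theorem empErr_nonneg {n : ℕ} (S : Fin n → X × Bool) (f : X → Bool) : 0 ≤ empErr S f := by
  unfold empErr; positivity

theorem empErr_le_one {n : ℕ} (S : Fin n → X × Bool) (f : X → Bool) : empErr S f ≤ 1 := by
  unfold empErr
  refine div_le_one_of_le₀ ?_ (by positivity)
  exact_mod_cast (Finset.card_filter_le _ _).trans (by simp)

variable [MeasurableSpace X]

theorem err_nonneg (D : Measure (X × Bool)) (f : X → Bool) : 0 ≤ err D f := measureReal_nonneg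

theorem err_le_one (D : Measure (X × Bool)) [IsProbabilityMeasure D] (f : X → Bool) :
    err D f ≤ 1 := measureReal_le_one

theorem measurableSet_mistake {f : X → Bool} (hf : Measurable f) :
    MeasurableSet {p : X × Bool | f p.1 ≠ p.2} :=
  (measurableSet_eq_fun (hf.comp measurable_fst) measurable_snd).compl

theorem measurable_mistake {f : X → Bool} (hf : Measurable f) : Measurable (mistake f) :=
  Measurable.ite (measurableSet_mistake hf) measurable_const measurable_const

theorem measurable_empErr {n : ℕ} {f : X → Bool} (hf : Measurable f) :
    Measurable fun S : Fin n → X × Bool => empErr S f := by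
  simp only [empErr_eq_sum]
  exact (Finset.measurable_sum _ fun j _ =>
    (measurable_mistake hf).comp (measurable_pi_apply j)).div_const _

theorem integrable_mistake (D : Measure (X × Bool)) [IsProbabilityMeasure D] {f : X → Bool}
    (hf : Measurable f) : Integrable (mistake f) D :=
  Integrable.of_bound (measurable_mistake hf).aestronglyMeasurable 1 (ae_of_all _ fun z => by
    rw [Real.norm_of_nonneg (mistake_nonneg f z)]; exact mistake_le_one f z)

theorem integral_mistake (D : Measure (X × Bool)) {f : X → Bool}
    (hf : Measurable f) : ∫ z, mistake f z ∂D = err D f := by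
  have : mistake f = ({p : X × Bool | f p.1 ≠ p.2}).indicator 1 := by
    funext z
    simp [mistake, Set.indicator_apply]
  rw [this, integral_indicator_one (measurableSet_mistake hf)]
  rfl

theorem integrable_empErr {n : ℕ} (μ : Measure (Fin n → X × Bool)) [IsProbabilityMeasure μ]
    {f : X → Bool} (hf : Measurable f) : Integrable (fun S => empErr S f) μ :=
  Integrable.of_bound (measurable_empErr hf).aestronglyMeasurable 1 (ae_of_all _ fun S => by
    rw [Real.norm_of_nonneg (empErr_nonneg S f)]; exact empErr_le_one S f)

theorem integral_empErr {n : ℕ} (hn : 0 < n) (D : Measure (X × Bool)) [IsProbabilityMeasure D]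
    {f : X → Bool} (hf : Measurable f) :
    ∫ S, empErr S f ∂(Measure.pi fun _ : Fin n => D) = err D f := by
  simp only [empErr_eq_sum]
  rw [integral_div, integral_finsetSum]
  · have : ∀ j : Fin n, ∫ S : Fin n → X × Bool, mistake f (S j) ∂(Measure.pi fun _ : Fin n => D)
        = err D f := by
      intro j
      have h := (measurePreserving_eval (fun _ : Fin n => D) j)
      rw [← integral_mistake D hf]
      conv_rhs => rw [← h.map_eq]
      exact (integral_map h.measurable.aemeasurable
        (measurable_mistake hf).aestronglyMeasurable).symm
    simp only [this, Finset.sum_const, Finset.card_univ, Fintype.card_fin, nsmul_eq_mul]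
    field_simp
  · intro j _
    exact (measurePreserving_eval (fun _ : Fin n => D) j).integrable_comp_of_integrable
      (integrable_mistake D hf)

/-- A `0`-`1` variable equals its square, so its variance is at most its mean. A variance linear in
the error underlies the relative second-moment estimates that follow. -/
theorem variance_empErr_le {n : ℕ} (hn : 0 < n) (D : Measure (X × Bool)) [IsProbabilityMeasure D]
    {f : X → Bool} (hf : Measurable f) :
    ProbabilityTheory.variance (fun S => empErr S f) (Measure.pi fun _ : Fin n => D) ≤
      err D f / n := by
  have hL : MemLp (mistake f) 2 D :=
    MemLp.of_bound (measurable_mistake hf).aestronglyMeasurable 1 (ae_of_all _ fun z => by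
      rw [Real.norm_of_nonneg (mistake_nonneg f z)]; exact mistake_le_one f z)
  have h1 : (fun S : Fin n → X × Bool => empErr S f) =
      fun S => (n : ℝ)⁻¹ * (∑ j, fun S : Fin n → X × Bool => mistake f (S j)) S := by
    funext S
    rw [empErr_eq_sum, Finset.sum_apply, div_eq_inv_mul]
  rw [h1, ProbabilityTheory.variance_const_mul,
    ProbabilityTheory.variance_sum_pi (X := fun _ => mistake f) fun _ => hL]
  have h2 : ProbabilityTheory.variance (mistake f) D ≤ err D f := by
    refine (ProbabilityTheory.variance_le_expectation_sq
      (measurable_mistake hf).aestronglyMeasurable).trans (le_of_eq ?_)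
    rw [← integral_mistake D hf]
    congr 1
    funext z
    rcases mistake_eq_zero_or_one f z with h | h <;> simp [h]
  simp only [Finset.sum_const, Finset.card_univ, Fintype.card_fin, nsmul_eq_mul]
  calc (n : ℝ)⁻¹ ^ 2 * (n * ProbabilityTheory.variance (mistake f) D)
      ≤ (n : ℝ)⁻¹ ^ 2 * (n * err D f) := by gcongr
    _ = err D f / n := by field_simp

/-- The second moment of the deviation of the empirical error. -/
theorem integral_empErr_sub_sq_le {n : ℕ} (hn : 0 < n) (D : Measure (X × Bool))
    [IsProbabilityMeasure D] {f : X → Bool} (hf : Measurable f) :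
    ∫ S, (empErr S f - err D f) ^ 2 ∂(Measure.pi fun _ : Fin n => D) ≤ err D f / n := by
  have := variance_empErr_le hn D hf
  rwa [ProbabilityTheory.variance_eq_integral (measurable_empErr hf).aemeasurable,
    integral_empErr hn D hf] at this

/-- A multiplicative Chernoff bound for the empirical error of a fixed classifier. -/
theorem pi_empErr_gt_le {n : ℕ} (D : Measure (X × Bool)) [IsProbabilityMeasure D]
    {f : X → Bool} (hf : Measurable f) {a e : ℝ} (ha : 0 < a) (ha1 : a ≤ 1) :
    (Measure.pi fun _ : Fin n => D) {S | (1 + a) * err D f + e < empErr S f} ≤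
      ENNReal.ofReal (Real.exp (-(a * e * n))) := by
  rcases Nat.eq_zero_or_pos n with rfl | hn
  · simp [prob_le_one]
  set μ := Measure.pi fun _ : Fin n => D
  have hn' : (0 : ℝ) < n := by exact_mod_cast hn
  have hsum : ∀ S : Fin n → X × Bool, a * (n * empErr S f) = ∑ j, a * mistake f (S j) := by
    intro S
    rw [empErr_eq_sum, ← Finset.mul_sum]
    field_simp
  have hexpm : Measurable fun S : Fin n → X × Bool => Real.exp (a * (n * empErr S f)) :=
    (((measurable_empErr hf).const_mul _).const_mul _).exp
  -- Exponential tilting by `a` itself: as `exp a ≤ 1 + a + a ^ 2` on `[0, 1]`, the exponent per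
  -- draw is `a * (1 + a) * err D f`. The threshold cancels this and only `e` survives.
  have hmgf1 : ∫ z, Real.exp (a * mistake f z) ∂D ≤ Real.exp (err D f * (a + a ^ 2)) := by
    have hpt : ∀ z, Real.exp (a * mistake f z) ≤ 1 + mistake f z * (a + a ^ 2) := by
      intro z
      rcases mistake_eq_zero_or_one f z with h | h
      · simp [h]
      · rw [h, mul_one, one_mul]
        have := Real.exp_bound' ha.le ha1 (n := 2) (by norm_num)
        norm_num [Finset.sum_range_succ, Nat.factorial] at this
        nlinarith
    have hint : Integrable (fun z => 1 + mistake f z * (a + a ^ 2)) D :=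
      (integrable_const _).add ((integrable_mistake D hf).mul_const _)
    calc ∫ z, Real.exp (a * mistake f z) ∂D ≤ ∫ z, (1 + mistake f z * (a + a ^ 2)) ∂D := by
          refine integral_mono_of_nonneg (ae_of_all _ fun z => (Real.exp_pos _).le) hint
            (ae_of_all _ hpt)
      _ = 1 + err D f * (a + a ^ 2) := by
          rw [integral_add (integrable_const _) ((integrable_mistake D hf).mul_const _),
            integral_mul_const, integral_mistake D hf]
          simp
      _ ≤ _ := by linarith [Real.add_one_le_exp (err D f * (a + a ^ 2))]
  have hmgf : ∫ S, Real.exp (a * (n * empErr S f)) ∂μ ≤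
      Real.exp (n * (err D f * (a + a ^ 2))) := by
    simp only [hsum, Real.exp_sum]
    rw [integral_fintype_prod_eq_prod (fun (_ : Fin n) z => Real.exp (a * mistake f z))]
    simp only [Finset.prod_const, Finset.card_univ, Fintype.card_fin]
    rw [Real.exp_nat_mul]
    exact pow_le_pow_left₀ (integral_nonneg fun z => (Real.exp_pos _).le) hmgf1 n
  have hint : Integrable (fun S => Real.exp (a * (n * empErr S f))) μ := by
    refine Integrable.of_bound hexpm.aestronglyMeasurable (Real.exp (a * n))
      (ae_of_all _ fun S => ?_)
    rw [Real.norm_of_nonneg (Real.exp_pos _).le]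
    refine Real.exp_le_exp.2 ?_
    have := mul_le_mul_of_nonneg_left (empErr_le_one S f) (by positivity : 0 ≤ a * (n : ℝ))
    linarith
  have hM := mul_meas_ge_le_integral_of_nonneg
    (ae_of_all _ fun S => (Real.exp_pos (a * (n * empErr S f))).le) hint
    (Real.exp (a * (n * ((1 + a) * err D f + e))))
  have hle : μ.real {S | (1 + a) * err D f + e < empErr S f} ≤ Real.exp (-(a * e * n)) := by
    have hsub : μ.real {S | (1 + a) * err D f + e < empErr S f} ≤
        μ.real {S | Real.exp (a * (n * ((1 + a) * err D f + e))) ≤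
          Real.exp (a * (n * empErr S f))} := by
      refine measureReal_mono (fun S hS => ?_)
      refine Real.exp_le_exp.2 ?_
      have : (1 + a) * err D f + e < empErr S f := hS
      gcongr
    have h3 := (mul_le_mul_of_nonneg_left hsub (Real.exp_pos _).le).trans (hM.trans hmgf)
    rw [mul_comm, ← le_div_iff₀ (Real.exp_pos _), ← Real.exp_sub] at h3
    refine h3.trans (le_of_eq ?_)
    ring_nf
  rw [← ENNReal.ofReal_toReal (measure_ne_top μ _)]
  exact ENNReal.ofReal_le_ofReal hle

end Mistake

/-! ### Measurability of the learned classifier and its errors -/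

section Oracle

variable {X : Type*} [MeasurableSpace X] {F : Set (X → Bool)} {τ : ℝ}
  {O : (n : ℕ) → (Fin n → X × Bool) → X → Bool}

theorem IsOracle.measurable_apply (hO : IsOracle F τ O) {m : ℕ} (S : Fin m → X × Bool) :
    Measurable (O m S) :=
  (hO.measurable m).comp measurable_prodMk_left

theorem IsOracle.measurableSet_mistake (hO : IsOracle F τ O) (m : ℕ) :
    MeasurableSet {q : (Fin m → X × Bool) × (X × Bool) | O m q.1 q.2.1 ≠ q.2.2} := by
  have h : Measurable fun q : (Fin m → X × Bool) × (X × Bool) => O m q.1 q.2.1 :=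
    (hO.measurable m).comp (measurable_fst.prodMk measurable_snd.fst)
  exact (measurableSet_eq_fun h measurable_snd.snd).compl

theorem IsOracle.measurable_mistake (hO : IsOracle F τ O) (m : ℕ) :
    Measurable fun q : (Fin m → X × Bool) × (X × Bool) => mistake (O m q.1) q.2 :=
  Measurable.ite (hO.measurableSet_mistake m) measurable_const measurable_const

theorem IsOracle.measurable_err (hO : IsOracle F τ O) (m : ℕ) (D : Measure (X × Bool))
    [IsProbabilityMeasure D] : Measurable fun S : Fin m → X × Bool => err D (O m S) :=
  (measurable_measure_prodMk_left (ν := D) (hO.measurableSet_mistake m)).ennreal_toReal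

theorem IsOracle.measurable_err_comp (hO : IsOracle F τ O) {m : ℕ} (D : Measure (X × Bool))
    [IsProbabilityMeasure D] {Ω : Type*} [MeasurableSpace Ω] {s : Ω → Fin m → X × Bool}
    (hs : Measurable s) : Measurable fun ω => err D (O m (s ω)) :=
  (hO.measurable_err m D).comp hs

theorem IsOracle.measurable_empErr_comp (hO : IsOracle F τ O) {m n : ℕ} {Ω : Type*}
    [MeasurableSpace Ω] {s : Ω → Fin m → X × Bool} {t : Ω → Fin n → X × Bool}
    (hs : Measurable s) (ht : Measurable t) : Measurable fun ω => empErr (t ω) (O m (s ω)) := by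
  simp only [empErr_eq_sum]
  refine (Finset.measurable_sum _ fun j _ => ?_).div_const _
  exact (hO.measurable_mistake m).comp (hs.prodMk ((measurable_pi_apply j).comp ht))

theorem IsOracle.measurable_empErr (hO : IsOracle F τ O) (m n : ℕ) :
    Measurable fun q : (Fin m → X × Bool) × (Fin n → X × Bool) => empErr q.2 (O m q.1) :=
  hO.measurable_empErr_comp measurable_fst measurable_snd

theorem IsOracle.measurable_empErr_self (hO : IsOracle F τ O) (m : ℕ) :
    Measurable fun S : Fin m → X × Bool => empErr S (O m S) :=
  hO.measurable_empErr_comp measurable_id measurable_id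

end Oracle

/-! ### Symmetrization with a ghost sample -/

section Symmetrization

variable {X : Type*}

/-- The second sample detects a classifier with a large error at least half of the time. -/
theorem half_le_pi_empErr_ge [MeasurableSpace X] {m : ℕ} (D : Measure (X × Bool))
    [IsProbabilityMeasure D] {f : X → Bool} (hf : Measurable f) {a e : ℝ} (ha : 0 < a)
    (he : 0 < e) (hm : 2 ≤ a * e * m) :
    2⁻¹ ≤ (Measure.pi fun _ : Fin m => D) {S | (1 - a / 2) * err D f - e / 2 ≤ empErr S f} := by
  set μ := Measure.pi fun _ : Fin m => D
  have hm0 : 0 < m := by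
    rcases Nat.eq_zero_or_pos m with rfl | h
    · norm_num at hm
    · exact h
  have hm' : (0 : ℝ) < m := by exact_mod_cast hm0
  have hq := err_nonneg D f
  set c := a / 2 * err D f + e / 2 with hc
  have hc0 : 0 < c := by positivity
  have hL : MemLp (fun S : Fin m → X × Bool => empErr S f) 2 μ :=
    MemLp.of_bound (measurable_empErr hf).aestronglyMeasurable 1 (ae_of_all _ fun S => by
      rw [Real.norm_of_nonneg (empErr_nonneg S f)]; exact empErr_le_one S f)
  have h1 := ProbabilityTheory.meas_ge_le_variance_div_sq hL hc0
  rw [integral_empErr hm0 D hf] at h1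
  have h2 : ProbabilityTheory.variance (fun S : Fin m → X × Bool => empErr S f) μ / c ^ 2 ≤
      1 / 2 := by
    rw [div_le_iff₀ (by positivity)]
    refine (variance_empErr_le hm0 D hf).trans ?_
    rw [div_le_iff₀ hm']
    -- By AM–GM, `c ^ 2 ≥ a * e * err D f`, so Chebyshev's quotient is at most `1 / (a * e * m) ≤ 1
    -- / 2`.
    have h3 : a * err D f * e ≤ c ^ 2 := by nlinarith [sq_nonneg (a / 2 * err D f - e / 2)]
    have h4 : a * err D f * e * m ≤ c ^ 2 * m := mul_le_mul_of_nonneg_right h3 hm'.le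
    have h5 : err D f * 2 ≤ err D f * (a * e * m) := mul_le_mul_of_nonneg_left hm hq
    linarith
  have h3 : μ {S | (1 - a / 2) * err D f - e / 2 ≤ empErr S f}ᶜ ≤ 2⁻¹ := by
    refine (measure_mono fun S hS => ?_).trans (h1.trans ((ENNReal.ofReal_le_ofReal h2).trans ?_))
    · have h6 : empErr S f < (1 - a / 2) * err D f - e / 2 := not_le.1 hS
      show c ≤ |empErr S f - err D f|
      rw [le_abs]
      right
      linarith
    · rw [one_div, ENNReal.ofReal_inv_of_pos (by norm_num)]; simp
  have hms : MeasurableSet {S : Fin m → X × Bool | (1 - a / 2) * err D f - e / 2 ≤ empErr S f} :=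
    measurableSet_le measurable_const (measurable_empErr hf)
  rw [prob_compl_eq_one_sub hms] at h3
  have h7 : (1 : ENNReal) ≤ 2⁻¹ + μ {S | (1 - a / 2) * err D f - e / 2 ≤ empErr S f} := by
    rw [add_comm]; exact (tsub_le_iff_left).1 h3 |>.trans (by rw [add_comm])
  rw [← ENNReal.inv_two_add_inv_two] at h7
  exact (ENNReal.add_le_add_iff_left (by simp)).1 h7

/-- Swap the components of a pair if `s` holds. -/
def swapIf (s : Bool) (z : (X × Bool) × (X × Bool)) : (X × Bool) × (X × Bool) :=
  if s then z.swap else z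

/-- The swaps of a double sample for which some hypothesis has many more mistakes on the second
half than on the first half are rare. -/
theorem card_bad_swap_le {F : Set (X → Bool)} {m : ℕ} {a e : ℝ} (ha : 0 < a) (ha1 : a ≤ 1)
    (he : 0 < e) (hm : 0 < m) (Z : Fin m → (X × Bool) × (X × Bool)) (s : Set (Fin m → Bool))
    (hs : ∀ σ ∈ s, ∃ f ∈ F, (1 + 2 * a) * empErr (fun j => (swapIf (σ j) (Z j)).1) f + 2 * e ≤
      empErr (fun j => (swapIf (σ j) (Z j)).2) f) :
    (s.ncard : ℝ) ≤
      (patterns F (Sum.elim (fun j => (Z j).1.1) fun j => (Z j).2.1)).card *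
        (2 ^ m * Real.exp (-(a * (e * m)))) := by
  classical
  have hm' : (0 : ℝ) < m := by exact_mod_cast hm
  set P := patterns F (Sum.elim (fun j => (Z j).1.1) fun j => (Z j).2.1)
  let b : (Fin m ⊕ Fin m → Bool) → Fin m → ℝ := fun p j =>
    if p (Sum.inl j) ≠ (Z j).1.2 then 1 else 0
  let b' : (Fin m ⊕ Fin m → Bool) → Fin m → ℝ := fun p j =>
    if p (Sum.inr j) ≠ (Z j).2.2 then 1 else 0
  let B : (Fin m ⊕ Fin m → Bool) → Finset (Fin m → Bool) := fun p =>
    Finset.univ.filter fun s : Fin m → Bool =>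
      a / 2 * ∑ j, (b p j + b' p j) + e * m ≤ ∑ j, swapSign (s j) * (b' p j - b p j)
  -- Swaps permute the `2m` points without changing the set of labellings that `F` realizes on them,
  -- so a union over `P` covers all swaps.
  have hsub : s ⊆ ((P.biUnion B : Finset (Fin m → Bool)) : Set (Fin m → Bool)) := by
    intro σ hσ
    obtain ⟨f, hf, hle⟩ := hs σ hσ
    rw [empErr_eq_sum, empErr_eq_sum] at hle
    set p : Fin m ⊕ Fin m → Bool := Sum.elim (fun j => f (Z j).1.1) fun j => f (Z j).2.1 with hp
    have hpP : p ∈ P := by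
      refine mem_patterns.2 ⟨f, hf, ?_⟩
      rintro (j | j) <;> rfl
    have hb : ∀ j, b p j = mistake f (Z j).1 := fun j => rfl
    have hb' : ∀ j, b' p j = mistake f (Z j).2 := fun j => rfl
    simp only [Finset.coe_biUnion, Set.mem_iUnion, Finset.mem_coe]
    refine ⟨p, hpP, Finset.mem_filter.2 ⟨Finset.mem_univ _, ?_⟩⟩
    simp only [hb, hb']
    set N₁ := ∑ j, mistake f (swapIf (σ j) (Z j)).1 with hN1
    set N₂ := ∑ j, mistake f (swapIf (σ j) (Z j)).2 with hN2
    have e1 : ∑ j, (mistake f (Z j).1 + mistake f (Z j).2) = N₁ + N₂ := by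
      rw [hN1, hN2, ← Finset.sum_add_distrib]
      refine Finset.sum_congr rfl fun j _ => ?_
      cases σ j <;> simp [swapIf, add_comm]
    have e2 : ∑ j, swapSign (σ j) * (mistake f (Z j).2 - mistake f (Z j).1) = N₂ - N₁ := by
      rw [hN1, hN2, ← Finset.sum_sub_distrib]
      refine Finset.sum_congr rfl fun j _ => ?_
      cases σ j <;> simp [swapIf, swapSign]
    have hN1' : 0 ≤ N₁ := Finset.sum_nonneg fun j _ => mistake_nonneg _ _
    have h3 : (1 + 2 * a) * N₁ + 2 * e * m ≤ N₂ := by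
      rw [le_div_iff₀ hm'] at hle
      have : ((1 + 2 * a) * (N₁ / m) + 2 * e) * m = (1 + 2 * a) * N₁ + 2 * e * m := by
        field_simp
      linarith
    rw [e1, e2]
    have h4 : 0 ≤ e * m := by positivity
    -- Multiply `h3` by `1 - a / 2` and use `(1 - a / 2) * (1 + 2 * a) ≥ 1 + a / 2`, which holds for
    -- `a ≤ 1`.
    nlinarith [mul_nonneg ha.le hN1']
  have h1 : s.ncard ≤ ∑ p ∈ P, (B p).card := by
    refine (Set.ncard_le_ncard hsub).trans ?_
    rw [Set.ncard_coe_finset]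
    exact Finset.card_biUnion_le
  calc (s.ncard : ℝ) ≤ ∑ p ∈ P, ((B p).card : ℝ) := by exact_mod_cast h1
    _ ≤ ∑ p ∈ P, 2 ^ m * Real.exp (-(a * (e * m))) := by
        refine Finset.sum_le_sum fun p _ => card_swap_le ha (b p) (b' p) (fun j => ?_) fun j => ?_
        · simp only [b]; split_ifs <;> simp
        · simp only [b']; split_ifs <;> simp
    _ = _ := by rw [Finset.sum_const, nsmul_eq_mul]

variable [MeasurableSpace X]

theorem measurePreserving_swapIf (D : Measure (X × Bool)) [IsProbabilityMeasure D] (s : Bool) :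
    MeasurePreserving (swapIf s) (D.prod D) (D.prod D) := by
  cases s
  · exact MeasurePreserving.id _
  · exact Measure.measurePreserving_swap

/-- Symmetrization by random swaps. -/
theorem prod_pi_le_of_card_swap_le {m : ℕ} (D : Measure (X × Bool)) [IsProbabilityMeasure D]
    {A : Set ((Fin m → X × Bool) × (Fin m → X × Bool))} (hA : MeasurableSet A) {c : ℝ}
    (hc : ∀ Z : Fin m → (X × Bool) × (X × Bool),
      (({σ : Fin m → Bool | ((fun j => (swapIf (σ j) (Z j)).1),
        fun j => (swapIf (σ j) (Z j)).2) ∈ A}).ncard : ℝ) ≤ c * 2 ^ m) :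
    ((Measure.pi fun _ : Fin m => D).prod (Measure.pi fun _ : Fin m => D)) A ≤
      ENNReal.ofReal c := by
  classical
  set ν := Measure.pi fun _ : Fin m => D.prod D
  have hmp := measurePreserving_arrowProdEquivProdArrow (X × Bool) (X × Bool) (Fin m)
    (fun _ => D) (fun _ => D)
  let g : (Fin m → Bool) → (Fin m → (X × Bool) × (X × Bool)) →
      (Fin m → X × Bool) × (Fin m → X × Bool) :=
    fun σ Z => ((fun j => (swapIf (σ j) (Z j)).1), fun j => (swapIf (σ j) (Z j)).2)
  have hg : ∀ σ, MeasurePreserving (g σ) ν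
      ((Measure.pi fun _ : Fin m => D).prod (Measure.pi fun _ : Fin m => D)) := fun σ =>
    hmp.comp (measurePreserving_pi (fun _ : Fin m => D.prod D) (fun _ => D.prod D)
      fun j => measurePreserving_swapIf D (σ j))
  -- Every fixed `σ` preserves the law of the double sample, so the measure of `A` is the average
  -- over `σ` of the measures of the preimages; exchanging sum and integral reduces it to a count
  -- for fixed `Z`.
  have h1 : ∀ σ, ((Measure.pi fun _ : Fin m => D).prod (Measure.pi fun _ : Fin m => D)) A =
      ∫⁻ Z, (g σ ⁻¹' A).indicator 1 Z ∂ν := by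
    intro σ
    rw [lintegral_indicator_one ((hg σ).measurable hA), (hg σ).measure_preimage hA.nullMeasurableSet]
  have h2 : ∑ _σ : Fin m → Bool,
      ((Measure.pi fun _ : Fin m => D).prod (Measure.pi fun _ : Fin m => D)) A ≤
      ENNReal.ofReal (c * 2 ^ m) := by
    rw [Finset.sum_congr rfl fun σ _ => h1 σ, ← lintegral_finsetSum _ fun σ _ =>
      measurable_one.indicator ((hg σ).measurable hA)]
    calc _ ≤ ∫⁻ _Z, ENNReal.ofReal (c * 2 ^ m) ∂ν := by
          refine lintegral_mono fun Z => ?_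
          refine le_trans (le_of_eq ?_) (ENNReal.ofReal_le_ofReal (hc Z))
          rw [ENNReal.ofReal_natCast, Set.ncard_eq_toFinset_card']
          simp only [Set.indicator_apply, Set.mem_preimage, Pi.one_apply, Finset.sum_boole]
          congr 2
          ext σ
          simp [g]
      _ = _ := by simp
  rw [Finset.sum_const, Finset.card_univ, Fintype.card_fun, Fintype.card_bool, Fintype.card_fin,
    nsmul_eq_mul, mul_comm c, ENNReal.ofReal_mul (by positivity),
    ENNReal.ofReal_pow (by norm_num)] at h2
  simp only [Nat.cast_pow, Nat.cast_ofNat, ENNReal.ofReal_ofNat] at h2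
  exact (ENNReal.mul_le_mul_iff_right (by simp) (by simp)).1 h2

/-- A relative uniform deviation bound: the hypothesis learned from a sample hardly ever has an
error that exceeds its empirical error. -/
theorem IsOracle.pi_err_gt_le {F : Set (X → Bool)} {τ : ℝ}
    {O : (n : ℕ) → (Fin n → X × Bool) → X → Bool} (hO : IsOracle F τ O) {d : ℕ}
    (hd : vcDim F ≤ d) (D : Measure (X × Bool)) [IsProbabilityMeasure D] {m : ℕ} {a e : ℝ}
    (ha : 0 < a) (ha1 : a ≤ 1 / 3) (he : 0 < e) (he1 : e ≤ 1) (hm : 2 ≤ a * e * m) :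
    (Measure.pi fun _ : Fin m => D)
        {S | (1 + 3 * a) * empErr S (O m S) + 3 * e < err D (O m S)} ≤
      ENNReal.ofReal (2 * Real.exp (d * Real.log (8 / (a * e)) - 3 / 4 * (a * e * m))) := by
  set μ := Measure.pi fun _ : Fin m => D
  have hm0 : 0 < m := by
    rcases Nat.eq_zero_or_pos m with rfl | h
    · norm_num at hm
    · exact h
  set B := {S : Fin m → X × Bool | (1 + 3 * a) * empErr S (O m S) + 3 * e < err D (O m S)}
  set A := {q : (Fin m → X × Bool) × (Fin m → X × Bool) |
    (1 + 2 * a) * empErr q.1 (O m q.1) + 2 * e ≤ empErr q.2 (O m q.1)}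
  have hB : MeasurableSet B := measurableSet_lt
    (((hO.measurable_empErr_self m).const_mul _).add_const _) (hO.measurable_err m D)
  have hA : MeasurableSet A := measurableSet_le
    ((((hO.measurable_empErr_self m).comp measurable_fst).const_mul _).add_const _)
    (hO.measurable_empErr m m)
  have h1 : 2⁻¹ * μ B ≤ (μ.prod μ) A := by
    rw [Measure.prod_apply hA]
    calc 2⁻¹ * μ B = ∫⁻ S, B.indicator (fun _ => 2⁻¹) S ∂μ := by
          rw [lintegral_indicator_const hB]
      _ ≤ _ := by
          refine lintegral_mono fun S => ?_
          by_cases hS : S ∈ B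
          · rw [Set.indicator_of_mem hS]
            refine (half_le_pi_empErr_ge D (hO.measurable_apply S) ha he hm).trans
              (measure_mono fun S' hS' => ?_)
            have h3 : (1 + 3 * a) * empErr S (O m S) + 3 * e < err D (O m S) := hS
            have h4 : (1 - a / 2) * err D (O m S) - e / 2 ≤ empErr S' (O m S) := hS'
            show (1 + 2 * a) * empErr S (O m S) + 2 * e ≤ empErr S' (O m S)
            refine le_trans ?_ h4
            -- Here `a ≤ 1 / 3` is needed: `(1 - a / 2) * (1 + 3 * a) ≥ 1 + 2 * a` and `3 * (1 - a /
            -- 2) - 1 / 2 ≥ 2`.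
            have h5 := mul_le_mul_of_nonneg_left h3.le (by linarith : 0 ≤ 1 - a / 2)
            have h6 := empErr_nonneg S (O m S)
            have h7 : 0 ≤ a * (1 / 2 - 3 / 2 * a) * empErr S (O m S) :=
              mul_nonneg (mul_nonneg ha.le (by linarith)) h6
            nlinarith
          · rw [Set.indicator_of_notMem hS]; exact zero_le
  -- With `x = a * e / 8` the `2m` points cost `a * e * m / 4` in the exponent; `3 / 4` of the
  -- deviation exponent remains.
  have hx0 : 0 < a * e / 8 := by positivity
  have hx1 : a * e / 8 ≤ 1 := by nlinarith
  have h2 : (μ.prod μ) A ≤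
      ENNReal.ofReal (Real.exp (d * Real.log (8 / (a * e)) - 3 / 4 * (a * e * m))) := by
    refine prod_pi_le_of_card_swap_le D hA fun Z => ?_
    -- The learned classifier changes with the swap, hence the need for a count that is uniform over
    -- `F`.
    refine (card_bad_swap_le (F := F) ha (by linarith) he hm0 Z _
      fun σ hσ => ⟨_, hO.mem _ _, hσ⟩).trans ?_
    have h3 := (Nat.cast_le (α := ℝ)).2
      (card_patterns_le hd (Sum.elim (fun j => (Z j).1.1) fun j => (Z j).2.1))
    have h4 := h3.trans (sum_choose_le_exp _ d hx0 hx1)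
    rw [one_div_div, Fintype.card_sum, Fintype.card_fin] at h4
    calc _ ≤ Real.exp (d * Real.log (8 / (a * e)) + (m + m : ℕ) * (a * e / 8)) *
          (2 ^ m * Real.exp (-(a * (e * m)))) := by gcongr
      _ = _ := by
          rw [mul_comm (2 ^ m : ℝ), ← mul_assoc, ← Real.exp_add]
          congr 2
          push_cast
          ring
  rw [ENNReal.ofReal_mul (by norm_num), ENNReal.ofReal_ofNat]
  have h3 := mul_le_mul_right (h1.trans h2) 2
  rwa [← mul_assoc, ENNReal.mul_inv_cancel (by simp) (by simp), one_mul] at h3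

end Symmetrization

/-! ### Good training samples -/

section Train

variable {X : Type*} [MeasurableSpace X]

/-- The training sample `S` is good: the error of the learned classifier on `D` is controlled by its
empirical error, which in turn is controlled by `P`. -/
def TrainGood (O : (n : ℕ) → (Fin n → X × Bool) → X → Bool) (a e P : ℝ) (D : Measure (X × Bool))
    {m : ℕ} (S : Fin m → X × Bool) : Prop :=
  err D (O m S) ≤ (1 + 3 * a) * empErr S (O m S) + 3 * e ∧
    empErr S (O m S) ≤ (1 + a) * P + 4 * e

variable {F : Set (X → Bool)} {O : (n : ℕ) → (Fin n → X × Bool) → X → Bool} {a e : ℝ}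

/-- The comparison hypothesis `f` is fixed before the sample is drawn, so a single Chernoff bound
controls its empirical error. Its excess `e` over `P` (an infimum need not be attained), the
Chernoff excess `e` and the oracle slack `e` add up to at most `4 * e`. -/
theorem IsOracle.pi_not_trainGood_le (hO : IsOracle F e O) {d : ℕ}
    (hd : vcDim F ≤ d) (D : Measure (X × Bool)) [IsProbabilityMeasure D] {m : ℕ}
    (ha : 0 < a) (ha1 : a ≤ 1 / 3) (he : 0 < e) (he1 : e ≤ 1) (hm : 2 ≤ a * e * m) {P : ℝ}
    {f : X → Bool} (hfF : f ∈ F) (hf : Measurable f) (hfP : err D f ≤ P + e) :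
    (Measure.pi fun _ : Fin m => D) {S | ¬ TrainGood O a e P D S} ≤
      ENNReal.ofReal (2 * Real.exp (d * Real.log (8 / (a * e)) - 3 / 4 * (a * e * m)) +
        Real.exp (-(a * e * m))) := by
  rw [ENNReal.ofReal_add (by positivity) (by positivity)]
  refine (measure_mono ?_).trans ((measure_union_le _ _).trans
    (add_le_add (hO.pi_err_gt_le hd D ha ha1 he he1 hm)
      (pi_empErr_gt_le D hf (e := e) ha (by linarith))))
  intro S hS
  by_contra hcon
  simp only [Set.mem_union, Set.mem_ofPred_eq, not_or, not_lt] at hcon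
  refine hS ⟨hcon.1, ?_⟩
  have h1 : (⨅ f : F, empErr S f.1) ≤ empErr S f :=
    ciInf_le (f := fun f : F => empErr S f.1)
      ⟨0, by rintro _ ⟨g, rfl⟩; exact empErr_nonneg S g.1⟩ ⟨f, hfF⟩
  have h2 := hO.empErr_le m S
  have h3 := mul_le_mul_of_nonneg_left hfP (by linarith : 0 ≤ 1 + a)
  nlinarith [hcon.2]

end Train

/-! ### Test samples: conditional moments of the increments -/

section Test

variable {X : Type*} [MeasurableSpace X]

/-- With `q = err D f` and `r = min q M / q ≤ 1`, the function `min · M` lies above `z ↦ min q M - r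
* |z - q|` on `z ≥ 0`. The mean deviation is at most `(a * q + e) / 2` by the second moment bound,
and `r * q = min q M` turns the loss into one relative to the truncated error. -/
theorem le_integral_min_empErr {n : ℕ} (D : Measure (X × Bool)) [IsProbabilityMeasure D]
    {f : X → Bool} (hf : Measurable f) {a e M : ℝ} (ha : 0 < a) (he : 0 < e)
    (hn : 1 ≤ a * e * n) (hM : 0 ≤ M) :
    (1 - a / 2) * min (err D f) M - e / 2 ≤
      ∫ T, min (empErr T f) M ∂(Measure.pi fun _ : Fin n => D) := by
  have hn0 : 0 < n := by
    rcases Nat.eq_zero_or_pos n with rfl | h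
    · norm_num at hn
    · exact h
  have hn' : (0 : ℝ) < n := by exact_mod_cast hn0
  set q := err D f with hq
  have hq0 : 0 ≤ q := err_nonneg D f
  set μ := Measure.pi fun _ : Fin n => D
  rcases hq0.eq_or_lt with hq00 | hqpos
  · rw [← hq00, min_eq_left hM]
    have : 0 ≤ ∫ T, min (empErr T f) M ∂μ :=
      integral_nonneg fun T => le_min (empErr_nonneg T f) hM
    linarith
  -- The AM–GM weight: variance at most `q / n` gives `c * q / n = a * q`, and `1 / c ≤ e` is the
  -- size condition on `n`.
  set c := a * n with hc
  have hc0 : 0 < c := by positivity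
  set r := min q M / q with hr
  have hr0 : 0 ≤ r := div_nonneg (le_min hq0 hM) hq0
  have hr1 : r ≤ 1 := div_le_one_of_le₀ (min_le_left _ _) hq0
  have hrq : r * q = min q M := div_mul_cancel₀ _ hqpos.ne'
  have hpt : ∀ T : Fin n → X × Bool,
      min q M - r * ((c * (empErr T f - q) ^ 2 + 1 / c) / 2) ≤ min (empErr T f) M := by
    intro T
    set Z := empErr T f
    have hZ : 0 ≤ Z := empErr_nonneg T f
    have h1 : |Z - q| ≤ (c * (Z - q) ^ 2 + 1 / c) / 2 := by
      have h2 : 0 ≤ (c * |Z - q| - 1) ^ 2 / c := by positivity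
      have h3 : (c * |Z - q| - 1) ^ 2 / c = c * |Z - q| ^ 2 + 1 / c - 2 * |Z - q| := by
        field_simp
        ring
      rw [sq_abs] at h3
      linarith
    have h2 : q - Z ≤ (c * (Z - q) ^ 2 + 1 / c) / 2 :=
      ((le_abs_self _).trans (by rw [abs_sub_comm])).trans h1
    have h3 := mul_le_mul_of_nonneg_left h2 hr0
    have h4 : 0 ≤ r * ((c * (Z - q) ^ 2 + 1 / c) / 2) := by positivity
    refine le_min ?_ ?_
    · nlinarith
    · linarith [min_le_right q M]
  have hb : ∀ T : Fin n → X × Bool, |empErr T f - q| ≤ 1 := by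
    intro T
    have h1 := empErr_nonneg T f
    have h2 := empErr_le_one T f
    have h3 : q ≤ 1 := err_le_one D f
    rw [abs_le]; constructor <;> linarith
  have hsq : Integrable (fun T : Fin n → X × Bool => (empErr T f - q) ^ 2) μ :=
    Integrable.of_bound (((measurable_empErr hf).sub_const _).pow_const _).aestronglyMeasurable 1
      (ae_of_all _ fun T => by
        rw [norm_pow, Real.norm_eq_abs]
        exact pow_le_one₀ (abs_nonneg _) (hb T))
  have hmin : Integrable (fun T : Fin n → X × Bool => min (empErr T f) M) μ :=
    Integrable.of_bound ((measurable_empErr hf).min measurable_const).aestronglyMeasurable 1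
      (ae_of_all _ fun T => by
        rw [Real.norm_of_nonneg (le_min (empErr_nonneg T f) hM)]
        exact (min_le_left _ _).trans (empErr_le_one T f))
  have hin : Integrable (fun T : Fin n → X × Bool =>
      r * ((c * (empErr T f - q) ^ 2 + 1 / c) / 2)) μ :=
    (((hsq.const_mul c).add (integrable_const _)).div_const 2).const_mul r
  have hI := integral_mono ((integrable_const _).sub hin) hmin hpt
  simp only [Pi.sub_apply] at hI
  rw [integral_sub (integrable_const _) hin, integral_const_mul,
    integral_div, integral_add (hsq.const_mul c) (integrable_const _), integral_const_mul] at hI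
  simp only [integral_const, probReal_univ, one_smul] at hI
  refine le_trans ?_ hI
  have hv := integral_empErr_sub_sq_le hn0 D hf
  rw [← hq] at hv
  have h1 : c * ∫ T, (empErr T f - q) ^ 2 ∂μ ≤ a * q := by
    refine (mul_le_mul_of_nonneg_left hv hc0.le).trans (le_of_eq ?_)
    rw [hc]; field_simp
  have h2 : 1 / c ≤ e := by
    rw [div_le_iff₀ hc0, hc]; linarith
  have h3 : r * ((c * ∫ T, (empErr T f - q) ^ 2 ∂μ + 1 / c) / 2) ≤ r * ((a * q + e) / 2) := by
    gcongr
  have h4 : r * e ≤ e := mul_le_of_le_one_left he.le hr1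
  nlinarith

/-- The lower bound for the expected increment of the weight of a player with error `q` when the
denominator in the increment is `B`. -/
def gain (a e B q : ℝ) : ℝ := max 0 (a ^ 2 / B * ((1 - a / 2) * min q (B / a) - e / 2))

theorem gain_nonneg (a e B q : ℝ) : 0 ≤ gain a e B q := le_max_left _ _

theorem measurable_gain (a e : ℝ) : Measurable fun p : ℝ × ℝ => gain a e p.1 p.2 := by
  unfold gain
  fun_prop

/-- Capping the increment at `a` amounts to capping the error at `B / a`, the level in `gain`. -/
theorem min_mul_sq_div_eq {a B z : ℝ} (ha : 0 < a) (hB : 0 < B) :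
    min (z * a ^ 2 / B) a = a ^ 2 / B * min z (B / a) := by
  rw [mul_min_of_nonneg _ _ (by positivity)]
  congr 1
  · ring
  · field_simp

theorem integral_increment_le {n : ℕ} (hn : 0 < n) (D : Measure (X × Bool))
    [IsProbabilityMeasure D] {f : X → Bool} (hf : Measurable f) {a B : ℝ} (ha : 0 < a)
    (hB : 0 < B) :
    ∫ T, min (empErr T f * a ^ 2 / B) a ∂(Measure.pi fun _ : Fin n => D) ≤
      err D f * a ^ 2 / B := by
  rw [← integral_empErr hn D hf, ← integral_mul_const, ← integral_div]
  refine integral_mono_of_nonneg (ae_of_all _ fun T => ?_)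
    (((integrable_empErr _ hf).mul_const _).div_const _) (ae_of_all _ fun T => min_le_left _ _)
  have := empErr_nonneg T f
  exact le_min (by positivity) ha.le

theorem gain_le_integral_increment {n : ℕ} (D : Measure (X × Bool))
    [IsProbabilityMeasure D] {f : X → Bool} (hf : Measurable f) {a e B : ℝ} (ha : 0 < a)
    (he : 0 < e) (hn : 1 ≤ a * e * n) (hB : 0 < B) :
    gain a e B (err D f) ≤
      ∫ T, min (empErr T f * a ^ 2 / B) a ∂(Measure.pi fun _ : Fin n => D) := by
  refine max_le (integral_nonneg fun T => ?_) ?_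
  · have := empErr_nonneg T f
    exact le_min (by positivity) ha.le
  · simp only [min_mul_sq_div_eq ha hB]
    rw [integral_const_mul]
    exact mul_le_mul_of_nonneg_left
      (le_integral_min_empErr D hf ha he hn (by positivity)) (by positivity)

/-- The inverse of the growth of a weight has an expectation that decays with the gain. -/
theorem lintegral_exp_gain_div_le {n : ℕ} (D : Measure (X × Bool))
    [IsProbabilityMeasure D] {f : X → Bool} (hf : Measurable f) {a e B : ℝ} (ha : 0 < a)
    (ha1 : a ≤ 1) (he : 0 < e) (hn : 1 ≤ a * e * n) (hB : 0 < B) :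
    ∫⁻ T, ENNReal.ofReal (Real.exp ((1 - a) * gain a e B (err D f)) /
      (1 + min (empErr T f * a ^ 2 / B) a)) ∂(Measure.pi fun _ : Fin n => D) ≤ 1 := by
  set μ := Measure.pi fun _ : Fin n => D
  set L := gain a e B (err D f)
  have hs0 : ∀ T : Fin n → X × Bool, 0 ≤ min (empErr T f * a ^ 2 / B) a := fun T => by
    have := empErr_nonneg T f
    exact le_min (by positivity) ha.le
  have hsm : Measurable fun T : Fin n → X × Bool => min (empErr T f * a ^ 2 / B) a :=
    (((measurable_empErr hf).mul_const _).div_const _).min measurable_const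
  have hsi : Integrable (fun T : Fin n → X × Bool => min (empErr T f * a ^ 2 / B) a) μ :=
    Integrable.of_bound hsm.aestronglyMeasurable a (ae_of_all _ fun T => by
      rw [Real.norm_of_nonneg (hs0 T)]; exact min_le_right _ _)
  -- This is where the cap is used: `(1 + s) * (1 - (1 - a) * s) ≥ 1` because `0 ≤ s ≤ a`.
  have hpt : ∀ T : Fin n → X × Bool, Real.exp ((1 - a) * L) /
      (1 + min (empErr T f * a ^ 2 / B) a) ≤
      Real.exp ((1 - a) * L) * (1 - (1 - a) * min (empErr T f * a ^ 2 / B) a) := by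
    intro T
    have h0 := hs0 T
    have h1 : min (empErr T f * a ^ 2 / B) a ≤ a := min_le_right _ _
    set s := min (empErr T f * a ^ 2 / B) a
    rw [div_eq_mul_inv]
    refine mul_le_mul_of_nonneg_left ?_ (Real.exp_pos _).le
    rw [inv_le_iff_one_le_mul₀ (by linarith)]
    nlinarith [mul_nonneg h0 (sub_nonneg.2 h1), mul_nonneg h0 (mul_nonneg h0 ha.le)]
  have hge : ∀ T : Fin n → X × Bool,
      0 ≤ Real.exp ((1 - a) * L) * (1 - (1 - a) * min (empErr T f * a ^ 2 / B) a) := fun T =>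
    le_trans (div_nonneg (Real.exp_pos _).le (by linarith [hs0 T])) (hpt T)
  have hint : Integrable (fun T : Fin n → X × Bool => Real.exp ((1 - a) * L) *
      (1 - (1 - a) * min (empErr T f * a ^ 2 / B) a)) μ :=
    ((integrable_const _).sub (hsi.const_mul _)).const_mul _
  calc _ ≤ ∫⁻ T, ENNReal.ofReal (Real.exp ((1 - a) * L) *
        (1 - (1 - a) * min (empErr T f * a ^ 2 / B) a)) ∂μ :=
        lintegral_mono fun T => ENNReal.ofReal_le_ofReal (hpt T)
    _ = ENNReal.ofReal (∫ T, Real.exp ((1 - a) * L) *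
        (1 - (1 - a) * min (empErr T f * a ^ 2 / B) a) ∂μ) := by
        rw [ofReal_integral_eq_lintegral_ofReal hint (ae_of_all _ hge)]
    _ ≤ ENNReal.ofReal 1 := by
        refine ENNReal.ofReal_le_ofReal ?_
        rw [integral_const_mul, integral_sub (integrable_const _) (hsi.const_mul _),
          integral_const_mul]
        simp only [integral_const, probReal_univ, one_smul]
        have h1 := gain_le_integral_increment D hf ha he hn hB
        have h2 : 1 - (1 - a) * ∫ T, min (empErr T f * a ^ 2 / B) a ∂μ ≤
            Real.exp (-((1 - a) * L)) := by
          have h3 := mul_le_mul_of_nonneg_left h1 (by linarith : 0 ≤ 1 - a)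
          linarith [Real.add_one_le_exp (-((1 - a) * L))]
        calc _ ≤ Real.exp ((1 - a) * L) * Real.exp (-((1 - a) * L)) :=
              mul_le_mul_of_nonneg_left h2 (Real.exp_pos _).le
          _ = 1 := by rw [← Real.exp_add]; simp
    _ = 1 := ENNReal.ofReal_one

end Test

/-! ### Errors and weights under a mixture -/

section Mixture

variable {X : Type*} [MeasurableSpace X] {k : ℕ}

theorem err_mixture (D : Fin k → Measure (X × Bool)) [∀ i, IsProbabilityMeasure (D i)]
    {w : Fin k → ℝ} (hw : ∀ i, 0 < w i) (f : X → Bool) :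
    err (mixture D w) f = ∑ i, w i / (∑ j, w j) * err (D i) f := by
  unfold err mixture
  rw [measureReal_def, Measure.finsetSum_apply, ENNReal.toReal_sum]
  · refine Finset.sum_congr rfl fun i _ => ?_
    rw [Measure.smul_apply, smul_eq_mul, ENNReal.toReal_mul, ENNReal.toReal_ofReal]
    · rfl
    · exact div_nonneg (hw i).le (Finset.sum_nonneg fun j _ => (hw j).le)
  · intro i _
    rw [Measure.smul_apply, smul_eq_mul]
    exact ENNReal.mul_ne_top ENNReal.ofReal_ne_top (measure_ne_top _ _)

theorem isProbabilityMeasure_mixture (hk : 0 < k) (D : Fin k → Measure (X × Bool))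
    [∀ i, IsProbabilityMeasure (D i)] {w : Fin k → ℝ} (hw : ∀ i, 0 < w i) :
    IsProbabilityMeasure (mixture D w) := by
  have hW : 0 < ∑ j, w j := Finset.sum_pos (fun j _ => hw j) ⟨⟨0, hk⟩, Finset.mem_univ _⟩
  constructor
  unfold mixture
  rw [Measure.finsetSum_apply]
  simp only [Measure.smul_apply, measure_univ, smul_eq_mul, mul_one]
  rw [← ENNReal.ofReal_sum_of_nonneg fun i _ => div_nonneg (hw i).le hW.le, ← Finset.sum_div,
    div_self hW.ne', ENNReal.ofReal_one]

/-- The expected growth of the total weight in a round with a good training sample. -/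
theorem sum_mul_one_add_le (D : Fin k → Measure (X × Bool)) [∀ i, IsProbabilityMeasure (D i)]
    {w : Fin k → ℝ} (hw : ∀ i, 0 < w i) {f : X → Bool} {a B : ℝ} (hB : 0 < B)
    (hf : err (mixture D w) f ≤ B) :
    ∑ i, w i * (1 + err (D i) f * a ^ 2 / B) ≤ (1 + a ^ 2) * ∑ i, w i := by
  rw [err_mixture D hw] at hf
  have h0 : 0 ≤ ∑ i, w i := Finset.sum_nonneg fun i _ => (hw i).le
  have h1 : ∑ i, w i * err (D i) f ≤ B * ∑ i, w i := by
    rcases h0.eq_or_lt with h | h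
    · have hk : ∀ i, w i = 0 := fun i =>
        (Finset.sum_eq_zero_iff_of_nonneg fun i _ => (hw i).le).1 h.symm i (Finset.mem_univ i)
      simp [hk]
    · have : ∑ i, w i / (∑ j, w j) * err (D i) f = (∑ i, w i * err (D i) f) / ∑ j, w j := by
        rw [Finset.sum_div]
        exact Finset.sum_congr rfl fun i _ => by ring
      rwa [this, div_le_iff₀ h] at hf
  have h2 : ∑ i, w i * (1 + err (D i) f * a ^ 2 / B) =
      ∑ i, w i + a ^ 2 / B * ∑ i, w i * err (D i) f := by
    rw [Finset.mul_sum, ← Finset.sum_add_distrib]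
    exact Finset.sum_congr rfl fun i _ => by ring
  have h3 := mul_le_mul_of_nonneg_left h1 (by positivity : 0 ≤ a ^ 2 / B)
  have h4 : a ^ 2 / B * (B * ∑ i, w i) = a ^ 2 * ∑ i, w i := by field_simp
  rw [h2]
  linarith

end Mixture

/-! ### Measurability of weights and of the law of a round -/

section Measurability

theorem measurable_snoc {E : Type*} [MeasurableSpace E] (r : ℕ) :
    Measurable fun p : (Fin r → E) × E => (Fin.snoc p.1 p.2 : Fin (r + 1) → E) := by
  refine measurable_pi_iff.2 fun q => ?_
  refine Fin.lastCases ?_ (fun q => ?_) q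
  · simpa only [Fin.snoc_last] using measurable_snd
  · simp only [Fin.snoc_castSucc]
    exact (measurable_pi_apply q).comp measurable_fst

theorem measurable_init {E : Type*} [MeasurableSpace E] (r : ℕ) :
    Measurable fun h : Fin (r + 1) → E => (Fin.init h : Fin r → E) :=
  measurable_pi_iff.2 fun q => measurable_pi_apply q.castSucc

variable {X : Type*} {F : Set (X → Bool)} {τ : ℝ}
  {O : (n : ℕ) → (Fin n → X × Bool) → X → Bool} {k m n : ℕ} {a e : ℝ}

theorem increment_nonneg (O : (n : ℕ) → (Fin n → X × Bool) → X → Bool) (ha : 0 < a) (he : 0 < e)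
    (R : Round X k m n) (i : Fin k) : 0 ≤ increment O a e R i := by
  have h1 := empErr_nonneg (R.2 i) (roundClassifier O R)
  have h2 := empErr_nonneg R.1 (roundClassifier O R)
  unfold increment
  exact le_min (by positivity) ha.le

theorem weight_pos (O : (n : ℕ) → (Fin n → X × Bool) → X → Bool) (ha : 0 < a) (he : 0 < e) {r : ℕ}
    (h : Fin r → Round X k m n) (i : Fin k) : 0 < weight O a e h i :=
  Finset.prod_pos fun q _ => by linarith [increment_nonneg O ha he (h q) i]

theorem weight_snoc (O : (n : ℕ) → (Fin n → X × Bool) → X → Bool) (a e : ℝ) {r : ℕ}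
    (h : Fin r → Round X k m n) (R : Round X k m n) (i : Fin k) :
    weight O a e (Fin.snoc h R : Fin (r + 1) → Round X k m n) i =
      weight O a e h i * (1 + increment O a e R i) := by
  simp [weight, Fin.prod_univ_castSucc]

variable [MeasurableSpace X]

theorem IsOracle.measurable_increment (hO : IsOracle F τ O) (a e : ℝ) (i : Fin k) :
    Measurable fun R : Round X k m n => increment O a e R i := by
  have h1 : Measurable fun R : Round X k m n => empErr (R.2 i) (O m R.1) :=
    hO.measurable_empErr_comp measurable_fst ((measurable_pi_apply i).comp measurable_snd)
  have h2 : Measurable fun R : Round X k m n => empErr R.1 (O m R.1) :=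
    hO.measurable_empErr_comp measurable_fst measurable_fst
  exact ((h1.mul_const _).div ((h2.const_mul _).add_const _)).min measurable_const

theorem IsOracle.measurable_weight (hO : IsOracle F τ O) (a e : ℝ) (r : ℕ) (i : Fin k) :
    Measurable fun h : Fin r → Round X k m n => weight O a e h i :=
  Finset.measurable_prod _ fun q _ =>
    measurable_const.add ((hO.measurable_increment a e i).comp (measurable_pi_apply q))

theorem measurable_mixture {Ω : Type*} [MeasurableSpace Ω] (D : Fin k → Measure (X × Bool))
    {w : Ω → Fin k → ℝ} (hw : ∀ i, Measurable fun ω => w ω i) {s : Set (X × Bool)} :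
    Measurable fun ω => mixture D (w ω) s := by
  simp only [mixture, Measure.finsetSum_apply, Measure.smul_apply, smul_eq_mul]
  exact Finset.measurable_sum _ fun i _ =>
    (((hw i).div (Finset.measurable_sum _ fun j _ => hw j)).ennreal_ofReal).mul_const _

theorem isProbabilityMeasure_roundLaw (hk : 0 < k) (m n : ℕ) (D : Fin k → Measure (X × Bool))
    [∀ i, IsProbabilityMeasure (D i)] {w : Fin k → ℝ} (hw : ∀ i, 0 < w i) :
    IsProbabilityMeasure (roundLaw m n D w) := by
  have := isProbabilityMeasure_mixture hk D hw
  unfold roundLaw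
  infer_instance

/-- For probability measures it suffices to test a generating π-system. On boxes the law is a
product of masses, of which only the mixture's depend on the weights. Measurability is what allows
the `bind` in `runLaw` to be evaluated as an iterated integral. -/
theorem measurable_roundLaw {Ω : Type*} [MeasurableSpace Ω] (hk : 0 < k) (m n : ℕ)
    (D : Fin k → Measure (X × Bool)) [∀ i, IsProbabilityMeasure (D i)]
    {w : Ω → Fin k → ℝ} (hw : ∀ i, Measurable fun ω => w ω i) (hw0 : ∀ ω i, 0 < w ω i) :
    Measurable fun ω => roundLaw m n D (w ω) := by
  have hmix := fun ω => isProbabilityMeasure_mixture hk D (hw0 ω)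
  have hpi : Measurable fun ω => Measure.pi fun _ : Fin m => mixture D (w ω) := by
    refine Measurable.measure_of_isPiSystem_of_isProbabilityMeasure generateFrom_pi.symm
      isPiSystem_pi ?_
    rintro _ ⟨s, -, rfl⟩
    simp only [Measure.pi_pi]
    exact Finset.measurable_prod _ fun j _ => measurable_mixture D hw
  have hround := fun ω => isProbabilityMeasure_roundLaw hk m n D (hw0 ω)
  refine Measurable.measure_of_isPiSystem_of_isProbabilityMeasure generateFrom_prod.symm
    isPiSystem_prod ?_
  rintro _ ⟨s, hs, t, -, rfl⟩
  replace hs : MeasurableSet s := hs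
  simp only [roundLaw, Measure.prod_prod]
  exact ((Measure.measurable_coe hs).comp hpi).mul_const _

end Measurability

/-! ### Induction over the rounds -/

section RunLaw

variable {X : Type*} [MeasurableSpace X] {F : Set (X → Bool)} {τ : ℝ}
  {O : (n : ℕ) → (Fin n → X × Bool) → X → Bool} {k : ℕ} {a e : ℝ}

theorem measurable_map_snoc (hO : IsOracle F τ O) (hk : 0 < k) (ha : 0 < a) (he : 0 < e) (m n : ℕ)
    (D : Fin k → Measure (X × Bool)) [∀ i, IsProbabilityMeasure (D i)] (r : ℕ) :
    Measurable fun h : Fin r → Round X k m n => (roundLaw m n D (weight O a e h)).map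
      fun R => (Fin.snoc h R : Fin (r + 1) → Round X k m n) := by
  have hκ := measurable_roundLaw hk m n D (fun i => hO.measurable_weight (m := m) (n := n) a e r i)
    (weight_pos O ha he)
  let κ : ProbabilityTheory.Kernel (Fin r → Round X k m n) (Round X k m n) :=
    ⟨fun h => roundLaw m n D (weight O a e h), hκ⟩
  have : ProbabilityTheory.IsMarkovKernel κ :=
    ⟨fun h => isProbabilityMeasure_roundLaw hk m n D (weight_pos O ha he h)⟩
  refine Measure.measurable_of_measurable_coe _ fun s hs => ?_
  have hms := measurable_snoc (E := Round X k m n) r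
  have h1 : ∀ h : Fin r → Round X k m n, (roundLaw m n D (weight O a e h)).map
      (fun R => (Fin.snoc h R : Fin (r + 1) → Round X k m n)) s =
      κ h (Prod.mk h ⁻¹' ((fun p : (Fin r → Round X k m n) × Round X k m n =>
        (Fin.snoc p.1 p.2 : Fin (r + 1) → Round X k m n)) ⁻¹' s)) := fun h =>
    Measure.map_apply (hms.comp measurable_prodMk_left) hs
  simp only [h1]
  exact ProbabilityTheory.Kernel.measurable_kernel_prodMk_left (hms hs)

/-- Integration over a run that is extended by one round. -/
theorem lintegral_runLaw_succ (hO : IsOracle F τ O) (hk : 0 < k) (ha : 0 < a) (he : 0 < e)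
    {m n : ℕ} (D : Fin k → Measure (X × Bool)) [∀ i, IsProbabilityMeasure (D i)] {r : ℕ}
    {V : (Fin (r + 1) → Round X k m n) → ENNReal} (hV : Measurable V) :
    ∫⁻ h, V h ∂(runLaw O a e m n D (r + 1)) =
      ∫⁻ h, ∫⁻ R, V (Fin.snoc h R : Fin (r + 1) → Round X k m n)
        ∂(roundLaw m n D (weight O a e h)) ∂(runLaw O a e m n D r) := by
  rw [runLaw, Measure.lintegral_bind (measurable_map_snoc hO hk ha he m n D r).aemeasurable
    hV.aemeasurable]
  refine lintegral_congr fun h => ?_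
  exact lintegral_map hV ((measurable_snoc r).comp measurable_prodMk_left)

theorem isProbabilityMeasure_runLaw (hO : IsOracle F τ O) (hk : 0 < k) (ha : 0 < a) (he : 0 < e)
    (m n : ℕ) (D : Fin k → Measure (X × Bool)) [∀ i, IsProbabilityMeasure (D i)] (r : ℕ) :
    IsProbabilityMeasure (runLaw O a e m n D r) := by
  induction r with
  | zero => rw [runLaw]; infer_instance
  | succ r ih =>
    constructor
    have h := lintegral_runLaw_succ hO hk ha he (m := m) (n := n) D (r := r) (V := fun _ => 1)
      measurable_const
    have hR := fun h : Fin r → Round X k m n =>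
      isProbabilityMeasure_roundLaw hk m n D (weight_pos O ha he h)
    simpa using h

/-- Integration of a function of the training sample and of the test sample of one player. -/
theorem lintegral_roundLaw_player (hk : 0 < k) {m n : ℕ} (D : Fin k → Measure (X × Bool))
    [∀ i, IsProbabilityMeasure (D i)] {w : Fin k → ℝ} (hw : ∀ i, 0 < w i) (i : Fin k)
    {V : (Fin m → X × Bool) → (Fin n → X × Bool) → ENNReal} (hV : Measurable (Function.uncurry V)) :
    ∫⁻ R, V R.1 (R.2 i) ∂(roundLaw m n D w) =
      ∫⁻ S, ∫⁻ T, V S T ∂(Measure.pi fun _ : Fin n => D i)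
        ∂(Measure.pi fun _ : Fin m => mixture D w) := by
  have := isProbabilityMeasure_mixture hk D hw
  have hm : Measurable fun R : Round X k m n => V R.1 (R.2 i) :=
    Measurable.comp (g := Function.uncurry V) hV
      (measurable_fst.prodMk ((measurable_pi_apply i).comp measurable_snd))
  rw [roundLaw, lintegral_prod _ hm.aemeasurable]
  refine lintegral_congr fun S => ?_
  exact (measurePreserving_eval (fun i : Fin k => Measure.pi fun _ : Fin n => D i) i).lintegral_comp
    (hV.comp measurable_prodMk_left)

/-- All training samples of the rounds so far are good. -/
def RunGood (O : (n : ℕ) → (Fin n → X × Bool) → X → Bool) (a e P : ℝ) {m n : ℕ}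
    (D : Fin k → Measure (X × Bool)) : (r : ℕ) → (Fin r → Round X k m n) → Prop
  | 0, _ => True
  | r + 1, h => RunGood O a e P D r (Fin.init h) ∧
      TrainGood O a e P (mixture D (weight O a e (Fin.init h))) (h (Fin.last r)).1

theorem runGood_snoc {P : ℝ} {m n : ℕ} {D : Fin k → Measure (X × Bool)} {r : ℕ}
    {h : Fin r → Round X k m n} {R : Round X k m n} :
    RunGood O a e P D (r + 1) (Fin.snoc h R) ↔
      RunGood O a e P D r h ∧ TrainGood O a e P (mixture D (weight O a e h)) R.1 := by
  simp [RunGood]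

theorem RunGood.empErr_le {P : ℝ} {m n : ℕ} {D : Fin k → Measure (X × Bool)} {r : ℕ}
    {h : Fin r → Round X k m n} (hg : RunGood O a e P D r h) (q : Fin r) :
    empErr (h q).1 (O m (h q).1) ≤ (1 + a) * P + 4 * e := by
  induction r with
  | zero => exact q.elim0
  | succ r ih =>
    refine Fin.lastCases ?_ (fun q => ?_) q
    · exact hg.2.2
    · exact ih hg.1 q

theorem measurableSet_trainGood (hO : IsOracle F τ O) (a e P : ℝ) {m : ℕ}
    (D : Measure (X × Bool)) [IsProbabilityMeasure D] :
    MeasurableSet {S : Fin m → X × Bool | TrainGood O a e P D S} :=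
  (measurableSet_le (hO.measurable_err m D)
    (((hO.measurable_empErr_self m).const_mul _).add_const _)).inter
    (measurableSet_le (hO.measurable_empErr_self m) measurable_const)

theorem measurableSet_runGood (hO : IsOracle F τ O) (ha : 0 < a) (he : 0 < e) (P : ℝ)
    {m n : ℕ} (D : Fin k → Measure (X × Bool)) [∀ i, IsProbabilityMeasure (D i)] (r : ℕ) :
    MeasurableSet {h : Fin r → Round X k m n | RunGood O a e P D r h} := by
  induction r with
  | zero => simp [RunGood]
  | succ r ih =>
    refine MeasurableSet.inter (measurable_init r ih) ?_
    have hS : Measurable fun h : Fin (r + 1) → Round X k m n => (h (Fin.last r)).1 :=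
      measurable_fst.comp (measurable_pi_apply _)
    have hemp : Measurable fun h : Fin (r + 1) → Round X k m n =>
        empErr (h (Fin.last r)).1 (O m (h (Fin.last r)).1) :=
      hO.measurable_empErr_comp hS hS
    have hw : ∀ i, Measurable fun h : Fin (r + 1) → Round X k m n =>
        weight O a e (Fin.init h : Fin r → Round X k m n) i := fun i =>
      Measurable.comp (g := fun h : Fin r → Round X k m n => weight O a e h i)
        (hO.measurable_weight a e r i) (measurable_init r)
    refine MeasurableSet.inter (measurableSet_le ?_ ((hemp.const_mul _).add_const _))
      (measurableSet_le hemp measurable_const)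
    -- Both the mixture and the classifier vary with the run; expanding over the players separates
    -- the two dependences.
    simp only [err_mixture D (weight_pos O ha he _)]
    refine Finset.measurable_sum _ fun i _ =>
      ((hw i).div (Finset.measurable_sum _ fun j _ => hw j)).mul ?_
    exact hO.measurable_err_comp (D i) hS

/-- A union bound over rounds. The past determines the mixture of a round, so the failure bound `η`
has to hold for all positive weights. -/
theorem runLaw_not_runGood_le (hO : IsOracle F τ O) (hk : 0 < k) (ha : 0 < a) (he : 0 < e) {P : ℝ}
    {m n : ℕ} (D : Fin k → Measure (X × Bool)) [∀ i, IsProbabilityMeasure (D i)] {η : ENNReal}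
    (hη : ∀ w : Fin k → ℝ, (∀ i, 0 < w i) → (Measure.pi fun _ : Fin m => mixture D w)
      {S | ¬ TrainGood O a e P (mixture D w) S} ≤ η) (r : ℕ) :
    runLaw O a e m n D r {h | ¬ RunGood O a e P D r h} ≤ r * η := by
  induction r with
  | zero => simp [RunGood]
  | succ r ih =>
    have hms := (measurableSet_runGood hO ha he P (m := m) (n := n) D (r + 1)).compl
    have hms' := (measurableSet_runGood hO ha he P (m := m) (n := n) D r).compl
    change runLaw O a e m n D (r + 1) {h | RunGood O a e P D (r + 1) h}ᶜ ≤ _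
    change runLaw O a e m n D r {h | RunGood O a e P D r h}ᶜ ≤ _ at ih
    have hprob := isProbabilityMeasure_runLaw hO hk ha he m n D r
    rw [← lintegral_indicator_one hms,
      lintegral_runLaw_succ hO hk ha he D (measurable_one.indicator hms)]
    calc _ ≤ ∫⁻ h, ({h | RunGood O a e P D r h}ᶜ.indicator 1 h + η) ∂(runLaw O a e m n D r) := by
          refine lintegral_mono fun h => ?_
          have hw := weight_pos O ha he h
          have hR := isProbabilityMeasure_roundLaw hk m n D hw
          have hmix := isProbabilityMeasure_mixture hk D hw
          by_cases hg : RunGood O a e P D r h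
          · refine le_trans ?_ ((hη _ hw).trans le_add_self)
            have hT := (measurableSet_trainGood hO a e P (m := m)
              (mixture D (weight O a e h))).compl
            have : ∀ R : Round X k m n, {h | RunGood O a e P D (r + 1) h}ᶜ.indicator
                (1 : (Fin (r + 1) → Round X k m n) → ENNReal) (Fin.snoc h R) =
                ({S | TrainGood O a e P (mixture D (weight O a e h)) S}ᶜ.indicator 1 R.1) := by
              intro R
              by_cases hR : TrainGood O a e P (mixture D (weight O a e h)) R.1
              · rw [Set.indicator_of_notMem (by exact fun hc => hc (runGood_snoc.2 ⟨hg, hR⟩)),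
                  Set.indicator_of_notMem (by exact fun hc => hc hR)]
              · rw [Set.indicator_of_mem (by exact fun hc => hR (runGood_snoc.1 hc).2),
                  Set.indicator_of_mem (by exact hR)]
                rfl
            simp only [this]
            have hi : Measurable fun R : Round X k m n =>
                {S | TrainGood O a e P (mixture D (weight O a e h)) S}ᶜ.indicator
                  (1 : (Fin m → X × Bool) → ENNReal) R.1 :=
              (measurable_one.indicator hT).comp measurable_fst
            rw [roundLaw, lintegral_prod _ hi.aemeasurable]
            simp only [lintegral_const, measure_univ, mul_one]
            rw [lintegral_indicator_one hT]
            rfl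
          -- After a bad past the first summand is already `1`, which bounds any conditional
          -- probability.
          · rw [Set.indicator_of_mem (by exact hg)]
            refine le_trans (lintegral_mono (g := fun _ => 1) fun R => ?_) ?_
            · exact Set.indicator_le_self _ _ _
            · simp
      _ ≤ _ := by
          rw [lintegral_add_right _ measurable_const, lintegral_indicator_one hms']
          simp only [lintegral_const, measure_univ, mul_one]
          push_cast
          rw [add_mul, one_mul]
          exact add_le_add_left ih _

/-- As long as the training samples are good, the total weight grows slowly on average. -/
theorem lintegral_weight_le (hO : IsOracle F τ O) (hk : 0 < k) (ha : 0 < a) (he : 0 < e) (P : ℝ)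
    {m n : ℕ} (hn : 0 < n) (D : Fin k → Measure (X × Bool)) [∀ i, IsProbabilityMeasure (D i)]
    (r : ℕ) :
    ∫⁻ h, {h | RunGood O a e P D r h}.indicator (fun h => ENNReal.ofReal (∑ i, weight O a e h i)) h
      ∂(runLaw O a e m n D r) ≤ ENNReal.ofReal ((1 + a ^ 2) ^ r * k) := by
  induction r with
  | zero =>
    have hprob := isProbabilityMeasure_runLaw hO hk ha he m n D 0
    refine (lintegral_mono (g := fun _ => ENNReal.ofReal k) fun h => ?_).trans (by simp)
    refine (Set.indicator_le_self _ _ _).trans (le_of_eq ?_)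
    simp [weight]
  | succ r ih =>
    have hmeas : ∀ r, Measurable fun h : Fin r → Round X k m n =>
        ENNReal.ofReal (∑ i, weight O a e h i) := fun r =>
      (Finset.measurable_sum _ fun i _ => hO.measurable_weight a e r i).ennreal_ofReal
    have hms := fun r => measurableSet_runGood hO ha he P (m := m) (n := n) D r
    rw [lintegral_runLaw_succ hO hk ha he D ((hmeas _).indicator (hms _))]
    have key : ∀ h : Fin r → Round X k m n,
        ∫⁻ R, {h | RunGood O a e P D (r + 1) h}.indicator
          (fun h => ENNReal.ofReal (∑ i, weight O a e h i))
          (Fin.snoc h R : Fin (r + 1) → Round X k m n) ∂(roundLaw m n D (weight O a e h)) ≤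
        ENNReal.ofReal (1 + a ^ 2) * {h | RunGood O a e P D r h}.indicator
          (fun h => ENNReal.ofReal (∑ i, weight O a e h i)) h := by
      intro h
      have hw := weight_pos O ha he h
      have hmix := isProbabilityMeasure_mixture hk D hw
      by_cases hg : RunGood O a e P D r h
      swap
      · refine le_trans (le_of_eq ?_) zero_le
        rw [← lintegral_zero (μ := roundLaw m n D (weight O a e h))]
        refine lintegral_congr fun R => Set.indicator_of_notMem ?_ _
        exact fun hc => hg (runGood_snoc.1 hc).1
      rw [Set.indicator_of_mem (by exact hg)]
      set G := {S : Fin m → X × Bool | TrainGood O a e P (mixture D (weight O a e h)) S} with hG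
      have hGm : MeasurableSet G := measurableSet_trainGood hO a e P _
      have hsplit : ∀ R : Round X k m n, {h | RunGood O a e P D (r + 1) h}.indicator
          (fun h => ENNReal.ofReal (∑ i, weight O a e h i))
          (Fin.snoc h R : Fin (r + 1) → Round X k m n) =
          ∑ i, G.indicator 1 R.1 *
            ENNReal.ofReal (weight O a e h i * (1 + increment O a e R i)) := by
        intro R
        rw [← Finset.mul_sum, ← ENNReal.ofReal_sum_of_nonneg fun i _ =>
          mul_nonneg (hw i).le (by linarith [increment_nonneg O ha he R i])]
        by_cases hR : R.1 ∈ G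
        · rw [Set.indicator_of_mem (by exact runGood_snoc.2 ⟨hg, hR⟩), Set.indicator_of_mem hR]
          simp only [weight_snoc, Pi.one_apply, one_mul]
        · have hR' : (Fin.snoc h R : Fin (r + 1) → Round X k m n) ∉
              {h | RunGood O a e P D (r + 1) h} := fun hc => hR (runGood_snoc.1 hc).2
          rw [Set.indicator_of_notMem hR',
            Set.indicator_of_notMem hR, zero_mul]
      simp only [hsplit]
      have hmi : ∀ i : Fin k, Measurable fun R : Round X k m n => G.indicator 1 R.1 *
            ENNReal.ofReal (weight O a e h i * (1 + increment O a e R i)) := fun i =>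
        ((measurable_one.indicator hGm).comp measurable_fst).mul
          (((measurable_const.add (hO.measurable_increment a e i)).const_mul _).ennreal_ofReal)
      rw [lintegral_finsetSum _ fun i _ => hmi i]
      -- Given the training sample, the factor of player `i` depends only on its own test sample.
      -- Integrating that sample out replaces the empirical error by the true one; dropping the cap
      -- only increases the bound.
      have hpl : ∀ i : Fin k, ∫⁻ R, G.indicator 1 R.1 *
            ENNReal.ofReal (weight O a e h i * (1 + increment O a e R i))
            ∂(roundLaw m n D (weight O a e h)) ≤
          ∫⁻ S, G.indicator 1 S * ENNReal.ofReal (weight O a e h i * (1 + err (D i) (O m S) * a ^ 2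
            / ((1 + 3 * a) * empErr S (O m S) + 3 * e)))
            ∂(Measure.pi fun _ : Fin m => mixture D (weight O a e h)) := by
        intro i
        have hV : Measurable (Function.uncurry
            fun (S : Fin m → X × Bool) (T : Fin n → X × Bool) => G.indicator (1 : (Fin m → X × Bool) → ENNReal) S *
              ENNReal.ofReal (weight O a e h i * (1 + min (empErr T (O m S) * a ^ 2 /
                ((1 + 3 * a) * empErr S (O m S) + 3 * e)) a))) := by
          have h1 : Measurable fun q : (Fin m → X × Bool) × (Fin n → X × Bool) =>
              empErr q.1 (O m q.1) :=
            hO.measurable_empErr_comp measurable_fst measurable_fst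
          exact ((measurable_one.indicator hGm).comp measurable_fst).mul
            ((measurable_const.add ((((hO.measurable_empErr m n).mul_const _).div
              ((h1.const_mul _).add_const _)).min measurable_const)).const_mul _).ennreal_ofReal
        refine (lintegral_roundLaw_player hk D hw i hV).trans_le (lintegral_mono fun S => ?_)
        have hB : 0 < (1 + 3 * a) * empErr S (O m S) + 3 * e := by
          have := empErr_nonneg S (O m S)
          positivity
        set B := (1 + 3 * a) * empErr S (O m S) + 3 * e
        have hf := hO.measurable_apply S
        have hTm : Measurable fun T : Fin n → X × Bool => min (empErr T (O m S) * a ^ 2 / B) a :=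
          (((measurable_empErr hf).mul_const _).div_const _).min measurable_const
        have hT0 : ∀ T : Fin n → X × Bool, 0 ≤ min (empErr T (O m S) * a ^ 2 / B) a := fun T => by
          have := empErr_nonneg T (O m S)
          exact le_min (by positivity) ha.le
        have hTi : Integrable (fun T : Fin n → X × Bool => min (empErr T (O m S) * a ^ 2 / B) a)
            (Measure.pi fun _ : Fin n => D i) :=
          Integrable.of_bound hTm.aestronglyMeasurable a (ae_of_all _ fun T => by
            rw [Real.norm_of_nonneg (hT0 T)]; exact min_le_right _ _)
        have hwi : Integrable (fun T : Fin n → X × Bool => weight O a e h i *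
            (1 + min (empErr T (O m S) * a ^ 2 / B) a)) (Measure.pi fun _ : Fin n => D i) :=
          ((integrable_const _).add hTi).const_mul _
        have hwm : Measurable fun T : Fin n → X × Bool => ENNReal.ofReal (weight O a e h i *
            (1 + min (empErr T (O m S) * a ^ 2 / B) a)) :=
          ((measurable_const.add hTm).const_mul _).ennreal_ofReal
        rw [lintegral_const_mul _ hwm, ← ofReal_integral_eq_lintegral_ofReal hwi
            (ae_of_all _ fun T => mul_nonneg (hw i).le (by linarith [hT0 T])),
          integral_const_mul, integral_add (integrable_const _) hTi]
        simp only [integral_const, probReal_univ, one_smul]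
        have := integral_increment_le hn (D i) hf ha hB
        have hwi := (hw i).le
        gcongr
      refine (Finset.sum_le_sum fun i _ => hpl i).trans ?_
      have hmS : ∀ i : Fin k, Measurable fun S : Fin m → X × Bool => G.indicator (1 : (Fin m → X × Bool) → ENNReal) S
          * ENNReal.ofReal (weight O a e h i * (1 + err (D i) (O m S) * a ^ 2
            / ((1 + 3 * a) * empErr S (O m S) + 3 * e))) := fun i =>
        (measurable_one.indicator hGm).mul
          ((measurable_const.add (((hO.measurable_err m (D i)).mul_const _).div
            (((hO.measurable_empErr_self m).const_mul _).add_const _))).const_mul _).ennreal_ofReal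
      rw [← lintegral_finsetSum _ fun i _ => hmS i, ← ENNReal.ofReal_mul (by positivity)]
      refine (lintegral_mono (g := fun _ => ENNReal.ofReal ((1 + a ^ 2) * ∑ i, weight O a e h i))
        fun S => ?_).trans (by simp)
      rw [← Finset.mul_sum]
      have hS0 := empErr_nonneg S (O m S)
      rw [← ENNReal.ofReal_sum_of_nonneg fun i _ => by
        have := err_nonneg (D i) (O m S)
        have := (hw i).le
        positivity]
      by_cases hS : S ∈ G
      · rw [Set.indicator_of_mem hS, Pi.one_apply, one_mul]
        -- The first half of goodness, error at most `B` on the mixture, yields the growth factor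
        -- pointwise in `S`.
        exact ENNReal.ofReal_le_ofReal (sum_mul_one_add_le D hw (by positivity) hS.1)
      · rw [Set.indicator_of_notMem hS, zero_mul]; exact zero_le
    refine (lintegral_mono key).trans ?_
    rw [lintegral_const_mul _ ((hmeas _).indicator (hms _)), pow_succ' (1 + a ^ 2), mul_assoc,
      ENNReal.ofReal_mul (by positivity)]
    exact mul_le_mul_right ih _

/-- The lower bound for the expected increment of the weight of player `i` in a round. -/
def roundGain (O : (n : ℕ) → (Fin n → X × Bool) → X → Bool) (a e : ℝ) {m : ℕ}
    (D : Measure (X × Bool)) (S : Fin m → X × Bool) : ℝ :=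
  gain a e ((1 + 3 * a) * empErr S (O m S) + 3 * e) (err D (O m S))

theorem IsOracle.measurable_roundGain_comp (hO : IsOracle F τ O) (a e : ℝ) {m : ℕ}
    (D : Measure (X × Bool)) [IsProbabilityMeasure D] {Ω : Type*} [MeasurableSpace Ω]
    {s : Ω → Fin m → X × Bool} (hs : Measurable s) :
    Measurable fun ω => roundGain O a e D (s ω) :=
  (measurable_gain a e).comp
    ((((hO.measurable_empErr_comp hs hs).const_mul (1 + 3 * a)).add_const (3 * e)).prodMk
      (hO.measurable_err_comp D hs))

/-- The ratio between the exponential of the total gain of player `i` and its weight. -/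
def gainRatio (O : (n : ℕ) → (Fin n → X × Bool) → X → Bool) (a e : ℝ) {m n : ℕ}
    (D : Fin k → Measure (X × Bool)) {r : ℕ} (h : Fin r → Round X k m n) (i : Fin k) : ℝ :=
  ∏ q, Real.exp ((1 - a) * roundGain O a e (D i) (h q).1) / (1 + increment O a e (h q) i)

theorem gainRatio_eq (O : (n : ℕ) → (Fin n → X × Bool) → X → Bool) (a e : ℝ) {m n : ℕ}
    (D : Fin k → Measure (X × Bool)) {r : ℕ} (h : Fin r → Round X k m n) (i : Fin k) :
    gainRatio O a e D h i =
      Real.exp ((1 - a) * ∑ q, roundGain O a e (D i) (h q).1) / weight O a e h i := by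
  rw [gainRatio, Finset.prod_div_distrib, ← Real.exp_sum, ← Finset.mul_sum]
  rfl

/-- A supermartingale argument: conditionally on the past and on the training sample, each new
factor has mean at most `1` by `lintegral_exp_gain_div_le`, whether or not that sample is good. -/
theorem lintegral_gainRatio_le (hO : IsOracle F τ O) (hk : 0 < k) (ha : 0 < a) (ha1 : a ≤ 1)
    (he : 0 < e) {m n : ℕ} (hn : 1 ≤ a * e * n) (D : Fin k → Measure (X × Bool))
    [∀ i, IsProbabilityMeasure (D i)] (i : Fin k) (r : ℕ) :
    Measurable (fun h : Fin r → Round X k m n => ENNReal.ofReal (gainRatio O a e D h i)) ∧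
    ∫⁻ h, ENNReal.ofReal (gainRatio O a e D h i) ∂(runLaw O a e m n D r) ≤ 1 := by
  have hmeas : ∀ r, Measurable fun h : Fin r → Round X k m n =>
      ENNReal.ofReal (gainRatio O a e D h i) := by
    intro r
    refine (Finset.measurable_prod _ fun q _ => ?_).ennreal_ofReal
    refine Measurable.div ?_
      (measurable_const.add ((hO.measurable_increment a e i).comp (measurable_pi_apply q)))
    exact ((hO.measurable_roundGain_comp a e (D i)
      (measurable_fst.comp (measurable_pi_apply q))).const_mul _).exp
  refine ⟨hmeas r, ?_⟩
  induction r with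
  | zero =>
    have hprob := isProbabilityMeasure_runLaw hO hk ha he m n D 0
    simp [gainRatio]
  | succ r ih =>
    rw [lintegral_runLaw_succ hO hk ha he D (hmeas _)]
    refine (lintegral_mono fun h => ?_).trans ih
    have hw := weight_pos O ha he h
    have hmix := isProbabilityMeasure_mixture hk D hw
    have h0 : 0 ≤ gainRatio O a e D h i := by
      rw [gainRatio_eq]
      exact div_nonneg (Real.exp_pos _).le (hw i).le
    have hsn : ∀ R : Round X k m n,
        ENNReal.ofReal (gainRatio O a e D (Fin.snoc h R : Fin (r + 1) → Round X k m n) i) =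
        ENNReal.ofReal (gainRatio O a e D h i) *
          ENNReal.ofReal (Real.exp ((1 - a) * roundGain O a e (D i) R.1) /
            (1 + increment O a e R i)) := by
      intro R
      rw [← ENNReal.ofReal_mul h0]
      simp only [gainRatio, Fin.prod_univ_castSucc, Fin.snoc_castSucc, Fin.snoc_last]
    simp only [hsn]
    have hV : Measurable (Function.uncurry
        fun (S : Fin m → X × Bool) (T : Fin n → X × Bool) =>
          ENNReal.ofReal (Real.exp ((1 - a) * roundGain O a e (D i) S) / (1 +
            min (empErr T (O m S) * a ^ 2 / ((1 + 3 * a) * empErr S (O m S) + 3 * e)) a))) := by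
      have h1 : Measurable fun q : (Fin m → X × Bool) × (Fin n → X × Bool) =>
          empErr q.1 (O m q.1) :=
        hO.measurable_empErr_comp measurable_fst measurable_fst
      have h2 : Measurable fun q : (Fin m → X × Bool) × (Fin n → X × Bool) =>
          roundGain O a e (D i) q.1 :=
        hO.measurable_roundGain_comp a e (D i) measurable_fst
      have h3 : Measurable fun q : (Fin m → X × Bool) × (Fin n → X × Bool) =>
          min (empErr q.2 (O m q.1) * a ^ 2 / ((1 + 3 * a) * empErr q.1 (O m q.1) + 3 * e)) a :=
        (((hO.measurable_empErr m n).mul_const _).div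
          ((h1.const_mul _).add_const _)).min measurable_const
      exact ((h2.const_mul _).exp.div (measurable_const.add h3)).ennreal_ofReal
    have hmR : Measurable fun R : Round X k m n =>
        ENNReal.ofReal (Real.exp ((1 - a) * roundGain O a e (D i) R.1) /
            (1 + increment O a e R i)) :=
      (((hO.measurable_roundGain_comp a e (D i) measurable_fst).const_mul _).exp.div
        (measurable_const.add (hO.measurable_increment a e i))).ennreal_ofReal
    rw [lintegral_const_mul _ hmR]
    refine (mul_le_mul_right (a := ENNReal.ofReal (gainRatio O a e D h i)) ?_).trans_eq (mul_one _)
    refine (lintegral_roundLaw_player hk D hw i hV).trans_le ?_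
    refine (lintegral_mono (g := fun _ => 1) fun S => ?_).trans (by simp)
    have := empErr_nonneg S (O m S)
    exact lintegral_exp_gain_div_le (D i) (hO.measurable_apply S) ha ha1 he hn (by positivity)

end RunLaw

/-! ### Deterministic analysis of the majority vote -/

section Majority

variable {X : Type*}

/-- Ties are harmless: with the label `false`, a wrong vote still has at least half of the voters
wrong, and the inequality is not strict. -/
theorem le_two_mul_card_mistake_of_maj {t : ℕ} (f : Fin t → X → Bool) {x : X} {y : Bool}
    (h : maj f x ≠ y) : t ≤ 2 * (Finset.univ.filter fun r => f r x ≠ y).card := by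
  have hcard := Finset.card_filter_add_card_filter_not (s := (Finset.univ : Finset (Fin t)))
    (fun r => f r x = true)
  rw [Finset.card_univ, Fintype.card_fin] at hcard
  cases y
  · have h1 : maj f x = true := by simpa using h
    simp only [maj, decide_eq_true_eq] at h1
    simp only [ne_eq, Bool.not_eq_false]
    omega
  · have h1 : ¬ maj f x = true := h
    simp only [maj, decide_eq_true_eq] at h1
    simp only [ne_eq]
    omega

variable [MeasurableSpace X]

theorem measurable_maj {t : ℕ} {f : Fin t → X → Bool} (hf : ∀ r, Measurable (f r)) :
    Measurable (maj f) :=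
  (Measurable.of_discrete (f := fun b : Fin t → Bool =>
    decide (t < 2 * (Finset.univ.filter fun r => b r = true).card))).comp (measurable_pi_iff.2 hf)

/-- The error of a majority vote is controlled by the errors of the classifiers outside of a small
set `K`. -/
theorem err_maj_mul_le {t : ℕ} (D : Measure (X × Bool)) [IsProbabilityMeasure D]
    {f : Fin t → X → Bool} (hf : ∀ r, Measurable (f r)) (K : Finset (Fin t)) :
    err D (maj f) * (t / 2 - K.card) ≤ ∑ r ∈ Kᶜ, err D (f r) := by
  have hpt : ∀ z, mistake (maj f) z * (t / 2 - K.card) ≤ ∑ r ∈ Kᶜ, mistake (f r) z := by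
    intro z
    by_cases hz : maj f z.1 = z.2
    · rw [show mistake (maj f) z = 0 by simp [mistake, hz], zero_mul]
      exact Finset.sum_nonneg fun r _ => mistake_nonneg _ _
    · rw [show mistake (maj f) z = 1 by simp [mistake, hz], one_mul]
      have h1 : (t : ℝ) ≤ 2 * (Finset.univ.filter fun r => f r z.1 ≠ z.2).card := by
        exact_mod_cast le_two_mul_card_mistake_of_maj f hz
      have h2 : ∑ r, mistake (f r) z = (Finset.univ.filter fun r => f r z.1 ≠ z.2).card := by
        simp [mistake, Finset.sum_ite]
      have h3 : ∑ r ∈ K, mistake (f r) z ≤ K.card := by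
        have := Finset.sum_le_sum fun r (_ : r ∈ K) => mistake_le_one (f r) z
        simpa using this
      have h4 := Finset.sum_add_sum_compl K fun r => mistake (f r) z
      linarith
  rw [← integral_mistake D (measurable_maj hf), ← integral_mul_const]
  simp only [← integral_mistake D (hf _)]
  rw [← integral_finsetSum _ fun r _ => integrable_mistake D (hf r)]
  exact integral_mono ((integrable_mistake D (measurable_maj hf)).mul_const _)
    (integrable_finsetSum _ fun r _ => integrable_mistake D (hf r)) hpt

/-- Here `γ` is the fraction of capped rounds, `ξ` the gain of the remaining ones in units of `a ^ 2
* t`, and `y` the error of the vote. Capped rounds shrink the quorum to `1 / 2 - γ`, but they use up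
the gain budget `1 / a` times faster. Hence `ξ` drops at least in proportion and the factor `1 / 2 -
γ` cancels. -/
theorem vote_bound {a e P γ ξ y : ℝ} (ha : 0 < a) (ha1 : a ≤ 1 / 40) (he : 0 < e) (hP : 0 ≤ P)
    (hγ0 : 0 ≤ γ) (hξ0 : 0 ≤ ξ) (htot : (1 - a) * (γ * (1 - a) + a * ξ) ≤ a * (1 + a))
    (hEy : (1 - a / 2) * (y * (1 / 2 - γ)) ≤ ((1 + 5 * a) * P + 8 * e) * ξ + e / 2) :
    y ≤ (2 + 40 * a) * P + 64 * e := by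
  set B := (1 + 5 * a) * P + 8 * e with hB
  have hB0 : 0 < B := by positivity
  have haξ : 0 ≤ a * ξ := mul_nonneg ha.le hξ0
  have ha2 : a * a ≤ a / 40 := by nlinarith
  have hγ1 : γ ≤ 1 / 4 := by
    have h1 : (39 / 40 : ℝ) * (γ * (39 / 40)) ≤ (1 - a) * (γ * (1 - a) + a * ξ) := by
      refine mul_le_mul (by linarith) ?_ (by positivity) (by linarith)
      have := mul_le_mul_of_nonneg_left (by linarith : (39 / 40 : ℝ) ≤ 1 - a) hγ0
      linarith
    have h2 : a * (1 + a) ≤ 41 / 1600 := by linarith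
    linarith
  -- Divide the budget by `a`; the coefficient of `γ` is then at least `(1 - a) * (2 * (1 + 3 *
  -- a))`, as `a ≤ 1 / 40` makes `a * (2 * (1 + 3 * a)) ≤ 1 - a`.
  have hξγ : (1 - a) * (ξ + 2 * (1 + 3 * a) * γ) ≤ 1 + a := by
    have h1 : a * (2 * (1 + 3 * a)) * γ ≤ (1 - a) * γ :=
      mul_le_mul_of_nonneg_right (by linarith) hγ0
    have h2 : (1 - a) * (a * (2 * (1 + 3 * a)) * γ + a * ξ) ≤
        (1 - a) * (γ * (1 - a) + a * ξ) :=
      mul_le_mul_of_nonneg_left (by linarith) (by linarith)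
    refine le_of_mul_le_mul_left (a := a) ?_ ha
    linarith
  have hξ1 : ξ ≤ (1 - a / 2) * (2 * (1 + 3 * a)) * (1 / 2 - γ) := by
    have h1 : 1 + a ≤ (1 - a) * ((1 - a / 2) * (1 + 3 * a)) := by
      have h2 : 0 ≤ a * (a * a) := by positivity
      linarith
    have h2 : ξ + 2 * (1 + 3 * a) * γ ≤ (1 - a / 2) * (1 + 3 * a) :=
      le_of_mul_le_mul_left (hξγ.trans h1) (by linarith)
    have h3 : 0 ≤ a * (1 + 3 * a) * γ := by positivity
    linarith
  have he1 : e / 2 ≤ (1 - a / 2) * (3 * e) * (1 / 2 - γ) := by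
    have h1 : (1 / 4 : ℝ) ≤ 1 / 2 - γ := by linarith
    have h2 : (79 / 80 : ℝ) ≤ 1 - a / 2 := by linarith
    have h3 : (79 / 80 : ℝ) * (1 / 4) ≤ (1 - a / 2) * (1 / 2 - γ) := by gcongr
    have h4 := mul_le_mul_of_nonneg_right h3 (by positivity : 0 ≤ 3 * e)
    linarith
  have hfin : (1 - a / 2) * (1 / 2 - γ) * y ≤
      (1 - a / 2) * (1 / 2 - γ) * (2 * (1 + 3 * a) * B + 3 * e) := by
    have h1 := mul_le_mul_of_nonneg_left hξ1 hB0.le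
    linarith
  have hpos : 0 < (1 - a / 2) * (1 / 2 - γ) := mul_pos (by linarith) (by linarith)
  refine (le_of_mul_le_mul_left hfin hpos).trans ?_
  have h1 : a * a * P ≤ a / 40 * P := mul_le_mul_of_nonneg_right ha2 hP
  have h2 : a * e ≤ 1 / 40 * e := mul_le_mul_of_nonneg_right ha1 he.le
  have h3 : 0 ≤ a * P := by positivity
  rw [hB]
  linarith

/-- If the total gain is small, then the majority vote has a small error. -/
theorem err_maj_le_of_sum_gain_le {t : ℕ} (ht : 0 < t) (D : Measure (X × Bool))
    [IsProbabilityMeasure D] {f : Fin t → X → Bool} (hf : ∀ r, Measurable (f r)) {a e P : ℝ}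
    (ha : 0 < a) (ha1 : a ≤ 1 / 40) (he : 0 < e) (hP : 0 ≤ P) {B : Fin t → ℝ}
    (hB0 : ∀ r, 3 * e ≤ B r) (hB1 : ∀ r, B r ≤ (1 + 5 * a) * P + 8 * e)
    (hgain : (1 - a) * ∑ r, gain a e (B r) (err D (f r)) ≤ a ^ 2 * t * (1 + a)) :
    err D (maj f) ≤ (2 + 40 * a) * P + 64 * e := by
  classical
  have ht' : (0 : ℝ) < t := by exact_mod_cast ht
  set B' := (1 + 5 * a) * P + 8 * e with hB'
  have hB'0 : 0 < B' := by positivity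
  set L : Fin t → ℝ := fun r => gain a e (B r) (err D (f r)) with hL
  -- Rounds whose gain is capped. Each has gain at least `a * (1 - a)`; outside `K` the gain
  -- controls the error itself.
  set K : Finset (Fin t) := Finset.univ.filter fun r => B r / a < err D (f r) with hK
  have hBpos : ∀ r, 0 < B r := fun r => by linarith [hB0 r]
  have hcap : ∀ r ∈ K, a * (1 - a) ≤ L r := by
    intro r hr
    refine le_trans ?_ (le_max_right _ _)
    rw [min_eq_right (Finset.mem_filter.1 hr).2.le]
    have h1 : a ^ 2 / B r * ((1 - a / 2) * (B r / a) - e / 2) =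
        a * (1 - a / 2) - a ^ 2 * (e / (2 * B r)) := by
      have := (hBpos r).ne'
      field_simp
    have h2 : e / (2 * B r) ≤ 1 / 2 := by
      rw [div_le_iff₀ (by linarith [hBpos r])]
      linarith [hB0 r]
    have h3 := mul_le_mul_of_nonneg_left h2 (sq_nonneg a)
    rw [h1]
    nlinarith
  have huncap : ∀ r ∈ Kᶜ, (1 - a / 2) * err D (f r) ≤ B' / a ^ 2 * L r + e / 2 := by
    intro r hr
    have hr' : err D (f r) ≤ B r / a := by
      by_contra hc
      exact Finset.mem_compl.1 hr (Finset.mem_filter.2 ⟨Finset.mem_univ _, not_le.1 hc⟩)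
    have h1 : a ^ 2 / B r * ((1 - a / 2) * err D (f r) - e / 2) ≤ L r := by
      have : L r = max 0 (a ^ 2 / B r * ((1 - a / 2) * min (err D (f r)) (B r / a) - e / 2)) := rfl
      rw [this, min_eq_left hr']
      exact le_max_right _ _
    have h2 : (1 - a / 2) * err D (f r) - e / 2 ≤ B r / a ^ 2 * L r := by
      have h3 := mul_le_mul_of_nonneg_left h1 (div_nonneg (hBpos r).le (sq_nonneg a))
      have h4 : B r / a ^ 2 * (a ^ 2 / B r * ((1 - a / 2) * err D (f r) - e / 2)) =
          (1 - a / 2) * err D (f r) - e / 2 := by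
        have := (hBpos r).ne'
        field_simp
      linarith
    have h5 : B r / a ^ 2 * L r ≤ B' / a ^ 2 * L r := by
      have := hB1 r
      have := gain_nonneg a e (B r) (err D (f r))
      gcongr
    linarith
  set c : ℝ := (K.card : ℝ) with hc
  have hc0 : 0 ≤ c := by positivity
  have hsumK : c * (a * (1 - a)) ≤ ∑ r ∈ K, L r := by
    have := Finset.card_nsmul_le_sum K L _ hcap
    rwa [nsmul_eq_mul] at this
  have hsplit := Finset.sum_add_sum_compl K L
  set x := ∑ r ∈ Kᶜ, L r with hx
  have hx0 : 0 ≤ x := Finset.sum_nonneg fun r _ => gain_nonneg _ _ _ _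
  have htot : (1 - a) * (c * (a * (1 - a)) + x) ≤ a ^ 2 * t * (1 + a) := by
    refine le_trans (mul_le_mul_of_nonneg_left ?_ (by linarith)) hgain
    linarith
  have hE : (1 - a / 2) * ∑ r ∈ Kᶜ, err D (f r) ≤ B' / a ^ 2 * x + t * (e / 2) := by
    rw [Finset.mul_sum]
    refine (Finset.sum_le_sum huncap).trans ?_
    rw [Finset.sum_add_distrib, ← Finset.mul_sum, Finset.sum_const, nsmul_eq_mul]
    have : ((Kᶜ.card : ℕ) : ℝ) ≤ t := by
      exact_mod_cast (Finset.card_le_univ _).trans (by simp)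
    have := mul_le_mul_of_nonneg_right this (by positivity : 0 ≤ e / 2)
    linarith
  have hmaj := err_maj_mul_le D hf K
  set y := err D (maj f)
  -- dividing by `a ^ 2 * t`
  set γ := c / t with hγ
  set ξ := x / (a ^ 2 * t) with hξ
  have hγ0 : 0 ≤ γ := by positivity
  have hξ0 : 0 ≤ ξ := by positivity
  have hcγ : c = γ * t := by rw [hγ]; field_simp
  have hxξ : x = ξ * (a ^ 2 * t) := by rw [hξ]; field_simp
  have htot' : (1 - a) * (γ * (1 - a) + a * ξ) ≤ a * (1 + a) := by
    rw [hcγ, hxξ] at htot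
    have h1 : (a * t) * ((1 - a) * (γ * (1 - a) + a * ξ)) ≤ (a * t) * (a * (1 + a)) := by
      linarith
    exact le_of_mul_le_mul_left h1 (by positivity)
  have hEy : (1 - a / 2) * (y * (1 / 2 - γ)) ≤ B' * ξ + e / 2 := by
    have h1 := (mul_le_mul_of_nonneg_left hmaj (by linarith : 0 ≤ 1 - a / 2)).trans hE
    rw [← hc, hcγ, hxξ] at h1
    have h2 : B' / a ^ 2 * (ξ * (a ^ 2 * t)) = B' * ξ * t := by field_simp
    rw [h2] at h1
    refine le_of_mul_le_mul_right (a := (t : ℝ)) ?_ ht'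
    linarith
  exact vote_bound ha ha1 he hP hγ0 hξ0 htot' hEy

end Majority

/-! ### Combining the events of a run -/

section Run

variable {X : Type*} [MeasurableSpace X] {F : Set (X → Bool)} {τ : ℝ}
  {O : (n : ℕ) → (Fin n → X × Bool) → X → Bool} {k : ℕ} {a e : ℝ}

theorem measure_ge_le_of_lintegral_le {Ω : Type*} [MeasurableSpace Ω] (μ : Measure Ω)
    {V : Ω → ENNReal} (hV : Measurable V) {b c : ℝ} (hc : 0 < c)
    (hb : ∫⁻ ω, V ω ∂μ ≤ ENNReal.ofReal b) :
    μ {ω | ENNReal.ofReal c ≤ V ω} ≤ ENNReal.ofReal (b / c) := by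
  have h := (mul_meas_ge_le_lintegral (μ := μ) hV (ENNReal.ofReal c)).trans hb
  rw [ENNReal.ofReal_div_of_pos hc, ENNReal.le_div_iff_mul_le (by simp [hc]) (by simp), mul_comm]
  exact h

/-- With high probability all training samples are good, the total weight is small, and no weight
is much smaller than its expected growth suggests. -/
theorem runLaw_compl_le (hO : IsOracle F τ O) (hk : 0 < k) (ha : 0 < a) (ha1 : a ≤ 1)
    (he : 0 < e) {P : ℝ} {m n : ℕ} (hn : 1 ≤ a * e * n) (D : Fin k → Measure (X × Bool))
    [∀ i, IsProbabilityMeasure (D i)] {r : ℕ} {δ : ℝ} (hδ : 0 < δ)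
    (hη : ∀ w : Fin k → ℝ, (∀ i, 0 < w i) → (Measure.pi fun _ : Fin m => mixture D w)
      {S | ¬ TrainGood O a e P (mixture D w) S} ≤ ENNReal.ofReal (δ / (4 * r))) :
    runLaw O a e m n D r {h | RunGood O a e P D r h ∧
      ∑ i, weight O a e h i ≤ 4 * k / δ * (1 + a ^ 2) ^ r ∧
      ∀ i, gainRatio O a e D h i ≤ 4 * k / δ}ᶜ ≤ ENNReal.ofReal δ := by
  have hk' : (0 : ℝ) < k := by exact_mod_cast hk
  have hn0 : 0 < n := by
    rcases Nat.eq_zero_or_pos n with rfl | h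
    · norm_num at hn
    · exact h
  set μ := runLaw O a e m n D r
  set U₁ := {h : Fin r → Round X k m n | ¬ RunGood O a e P D r h}
  -- The indicator is essential: the growth of the total weight is controlled only along good runs.
  set W : (Fin r → Round X k m n) → ENNReal := {h | RunGood O a e P D r h}.indicator
    (fun h => ENNReal.ofReal (∑ i, weight O a e h i))
  set U₂ := {h | ENNReal.ofReal (4 * k / δ * (1 + a ^ 2) ^ r) ≤ W h}
  set U₃ : Fin k → Set (Fin r → Round X k m n) := fun i =>
    {h | ENNReal.ofReal (4 * k / δ) ≤ ENNReal.ofReal (gainRatio O a e D h i)}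
  have hW : Measurable W :=
    (Finset.measurable_sum _ fun i _ => hO.measurable_weight a e r i).ennreal_ofReal.indicator
      (measurableSet_runGood hO ha he P D r)
  have h1 : μ U₁ ≤ ENNReal.ofReal (δ / 4) := by
    refine (runLaw_not_runGood_le hO hk ha he D hη r).trans ?_
    rw [← ENNReal.ofReal_natCast, ← ENNReal.ofReal_mul (by positivity)]
    refine ENNReal.ofReal_le_ofReal ?_
    rcases Nat.eq_zero_or_pos r with rfl | hr
    · simp; positivity
    · have : (0 : ℝ) < r := by exact_mod_cast hr
      exact le_of_eq (by field_simp)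
  have h2 : μ U₂ ≤ ENNReal.ofReal (δ / 4) := by
    refine (measure_ge_le_of_lintegral_le μ hW (by positivity)
      (lintegral_weight_le hO hk ha he P hn0 D r)).trans (ENNReal.ofReal_le_ofReal (le_of_eq ?_))
    field_simp
  have h3 : ∀ i, μ (U₃ i) ≤ ENNReal.ofReal (δ / (4 * k)) := by
    intro i
    obtain ⟨hm, hle⟩ := lintegral_gainRatio_le hO hk ha ha1 he (m := m) hn D i r
    refine (measure_ge_le_of_lintegral_le μ hm (b := 1) (by positivity) (by simpa using hle)).trans
      (ENNReal.ofReal_le_ofReal (le_of_eq ?_))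
    field_simp
  have h3' : μ (⋃ i, U₃ i) ≤ ENNReal.ofReal (δ / 4) := by
    refine (measure_iUnion_fintype_le μ U₃).trans ((Finset.sum_le_sum fun i _ => h3 i).trans ?_)
    rw [Finset.sum_const, Finset.card_univ, Fintype.card_fin, nsmul_eq_mul,
      ← ENNReal.ofReal_natCast, ← ENNReal.ofReal_mul (by positivity)]
    exact ENNReal.ofReal_le_ofReal (le_of_eq (by field_simp))
  have hsub : {h : Fin r → Round X k m n | RunGood O a e P D r h ∧
      ∑ i, weight O a e h i ≤ 4 * k / δ * (1 + a ^ 2) ^ r ∧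
      ∀ i, gainRatio O a e D h i ≤ 4 * k / δ}ᶜ ⊆ U₁ ∪ (U₂ ∪ ⋃ i, U₃ i) := by
    intro h hh
    by_contra hcon
    simp only [Set.mem_union, Set.mem_iUnion, not_or, not_exists] at hcon
    obtain ⟨hc1, hc2, hc3⟩ := hcon
    have hg : RunGood O a e P D r h := not_not.1 hc1
    refine hh ⟨hg, ?_, fun i => ?_⟩
    · by_contra hlt
      refine hc2 ?_
      show _ ≤ W h
      rw [show W h = ENNReal.ofReal (∑ i, weight O a e h i) from Set.indicator_of_mem (by exact hg) _]
      exact ENNReal.ofReal_le_ofReal (not_le.1 hlt).le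
    · by_contra hlt
      exact hc3 i (ENNReal.ofReal_le_ofReal (not_le.1 hlt).le)
  calc _ ≤ μ (U₁ ∪ (U₂ ∪ ⋃ i, U₃ i)) := measure_mono hsub
    _ ≤ ENNReal.ofReal (δ / 4) + (ENNReal.ofReal (δ / 4) + ENNReal.ofReal (δ / 4)) :=
        (measure_union_le _ _).trans
          (add_le_add h1 ((measure_union_le _ _).trans (add_le_add h2 h3')))
    _ ≤ ENNReal.ofReal δ := by
        rw [← ENNReal.ofReal_add (by positivity) (by positivity),
          ← ENNReal.ofReal_add (by positivity) (by positivity)]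
        exact ENNReal.ofReal_le_ofReal (by linarith)

/-- The deterministic part of the analysis: the majority vote of a good run has a small error. -/
theorem RunGood.err_maj_le (hO : IsOracle F τ O) (ha : 0 < a)
    (ha1 : a ≤ 1 / 40) (he : 0 < e) {P : ℝ} (hP : 0 ≤ P) {m n : ℕ}
    (D : Fin k → Measure (X × Bool)) [∀ i, IsProbabilityMeasure (D i)] {t : ℕ} (ht : 0 < t)
    {Λ : ℝ} (hΛ : 0 < Λ) (hlog : 2 * Real.log Λ ≤ a ^ 3 * t)
    {h : Fin t → Round X k m n} (hg : RunGood O a e P D t h)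
    (hΦ : ∑ i, weight O a e h i ≤ Λ * (1 + a ^ 2) ^ t) {i : Fin k}
    (hw : gainRatio O a e D h i ≤ Λ) :
    err (D i) (maj fun r => roundClassifier O (h r)) ≤ (2 + 40 * a) * P + 64 * e := by
  refine err_maj_le_of_sum_gain_le ht (D i) (fun r => hO.measurable_apply _) ha ha1 he hP
    (B := fun r => (1 + 3 * a) * empErr (h r).1 (O m (h r).1) + 3 * e) (fun r => ?_) (fun r => ?_) ?_
  · have := empErr_nonneg (h r).1 (O m (h r).1)
    have : 0 ≤ (1 + 3 * a) * empErr (h r).1 (O m (h r).1) := by positivity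
    linarith
  -- `(1 + 3a)(1 + a) ≤ 1 + 5a` and `4(1 + 3a) + 3 ≤ 8` for `a ≤ 1/40`.
  · have h1 := mul_le_mul_of_nonneg_left (hg.empErr_le r) (by linarith : 0 ≤ 1 + 3 * a)
    nlinarith [mul_nonneg (mul_nonneg ha.le hP) (sub_nonneg.2 ha1),
      mul_nonneg he.le (sub_nonneg.2 ha1)]
  · have hpos := weight_pos O ha he h
    rw [gainRatio_eq, div_le_iff₀ (hpos i)] at hw
    have h1 : weight O a e h i ≤ ∑ i, weight O a e h i :=
      Finset.single_le_sum (fun j _ => (hpos j).le) (Finset.mem_univ i)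
    have h2 : (1 + a ^ 2) ^ t ≤ Real.exp (t * a ^ 2) := by
      rw [Real.exp_nat_mul]
      exact pow_le_pow_left₀ (by positivity) (by linarith [Real.add_one_le_exp (a ^ 2)]) t
    -- One factor `Λ` comes from the gain ratio and one from the total weight; this is the reason
    -- for the `2` in the number of rounds.
    have h3 : Real.exp ((1 - a) * ∑ q, roundGain O a e (D i) (h q).1) ≤
        Real.exp (2 * Real.log Λ + t * a ^ 2) := by
      refine hw.trans ?_
      rw [Real.exp_add, two_mul, Real.exp_add, Real.exp_log hΛ, mul_assoc]
      exact mul_le_mul_of_nonneg_left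
        ((h1.trans hΦ).trans (mul_le_mul_of_nonneg_left h2 hΛ.le)) hΛ.le
    have h4 := Real.exp_le_exp.1 h3
    change (1 - a) * ∑ q, roundGain O a e (D i) (h q).1 ≤ _
    linarith

end Run

/-! ### Choice of parameters and the accuracy guarantee -/

section Accuracy

variable {X : Type*} [MeasurableSpace X] {F : Set (X → Bool)} {τ : ℝ}
  {O : (n : ℕ) → (Fin n → X × Bool) → X → Bool} {k : ℕ}

theorem OPT_nonneg (F : Set (X → Bool)) (D : Fin k → Measure (X × Bool)) : 0 ≤ OPT F D :=
  Real.iInf_nonneg fun f => Real.iSup_nonneg fun i => err_nonneg (D i) f.1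

theorem exists_err_le_OPT_add (hF : F.Nonempty) (D : Fin k → Measure (X × Bool)) {e : ℝ}
    (he : 0 < e) : ∃ f ∈ F, ∀ i, err (D i) f ≤ OPT F D + e := by
  have : Nonempty F := hF.to_subtype
  obtain ⟨f, hf⟩ := exists_lt_of_ciInf_lt (show OPT F D < OPT F D + e by linarith)
  exact ⟨f.1, f.2, fun i =>
    (le_ciSup (f := fun i => err (D i) f.1) (Set.finite_range _).bddAbove i).trans hf.le⟩

theorem err_mixture_le (hk : 0 < k) (D : Fin k → Measure (X × Bool))
    [∀ i, IsProbabilityMeasure (D i)] {w : Fin k → ℝ} (hw : ∀ i, 0 < w i) {f : X → Bool} {b : ℝ}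
    (hf : ∀ i, err (D i) f ≤ b) : err (mixture D w) f ≤ b := by
  have hW : 0 < ∑ j, w j := Finset.sum_pos (fun j _ => hw j) ⟨⟨0, hk⟩, Finset.mem_univ _⟩
  rw [err_mixture D hw]
  calc _ ≤ ∑ i, w i / (∑ j, w j) * b := Finset.sum_le_sum fun i _ =>
        mul_le_mul_of_nonneg_left (hf i) (div_nonneg (hw i).le hW.le)
    _ = b := by rw [← Finset.sum_mul, ← Finset.sum_div, div_self hW.ne', one_mul]

/-- From `2 * e ≤ a` and `e ≤ 1 / 64` follows `8 / (a * e) ≤ e ^ (-3)`. With the constant `4`, the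
`3 / 4` of the exponent then pays for `3 * d * log (1 / e)` and leaves `η ^ 3`, so the three terms
sum to at most `3 * η / 64`. -/
theorem train_failure_le {d m : ℕ} {a e η : ℝ} (ha : 0 < a) (hea : 2 * e ≤ a) (he : 0 < e)
    (he1 : e ≤ 1 / 64) (hη : 0 < η) (hη1 : η ≤ 1 / 8)
    (hm : 4 / (a * e) * (d * Real.log (1 / e) + Real.log (1 / η)) ≤ m) :
    2 ≤ a * e * m ∧ 2 * Real.exp (d * Real.log (8 / (a * e)) - 3 / 4 * (a * e * m)) +
      Real.exp (-(a * e * m)) ≤ η := by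
  have hae : 0 < a * e := mul_pos ha he
  have hle : 0 ≤ Real.log (1 / e) := Real.log_nonneg (by rw [le_div_iff₀ he]; linarith)
  have h1 : 4 * (d * Real.log (1 / e) + Real.log (1 / η)) ≤ a * e * m := by
    have := mul_le_mul_of_nonneg_left hm hae.le
    have h2 : a * e * (4 / (a * e) * (d * Real.log (1 / e) + Real.log (1 / η))) =
        4 * (d * Real.log (1 / e) + Real.log (1 / η)) := by field_simp
    linarith
  have hlη : 2 ≤ Real.log (1 / η) := by
    have h8 : (8 : ℝ) ≤ 1 / η := by rw [le_div_iff₀ hη]; linarith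
    have h2 := Real.log_le_log (by norm_num) h8
    rw [show (8 : ℝ) = 2 ^ 3 by norm_num, Real.log_pow] at h2
    have := Real.log_two_gt_d9
    push_cast at h2
    linarith
  have h8 : Real.log (8 / (a * e)) ≤ 3 * Real.log (1 / e) := by
    rw [show (3 : ℝ) * Real.log (1 / e) = Real.log ((1 / e) ^ 3) by rw [Real.log_pow]; norm_num]
    refine Real.log_le_log (by positivity) ?_
    rw [one_div, inv_pow, ← one_div, div_le_div_iff₀ hae (by positivity)]
    have h3 : e * (2 * e) ≤ e * a := mul_le_mul_of_nonneg_left hea he.le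
    have h4 : e ^ 3 ≤ 1 / 64 * e ^ 2 := by
      rw [pow_succ']; exact mul_le_mul_of_nonneg_right he1 (by positivity)
    nlinarith
  have hd0 : 0 ≤ d * Real.log (1 / e) := by positivity
  have hd8 : d * Real.log (8 / (a * e)) ≤ d * (3 * Real.log (1 / e)) :=
    mul_le_mul_of_nonneg_left h8 (by positivity)
  have hexp : Real.exp (-(3 * Real.log (1 / η))) = η ^ 3 := by
    rw [one_div, Real.log_inv, mul_neg, neg_neg, show (3 : ℝ) = (3 : ℕ) by norm_num,
      Real.exp_nat_mul, Real.exp_log hη]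
  refine ⟨by linarith, ?_⟩
  have e1 : Real.exp (d * Real.log (8 / (a * e)) - 3 / 4 * (a * e * m)) ≤ η ^ 3 := by
    rw [← hexp]; exact Real.exp_le_exp.2 (by linarith)
  have e2 : Real.exp (-(a * e * m)) ≤ η ^ 3 := by
    rw [← hexp]; exact Real.exp_le_exp.2 (by linarith)
  have e3 : η ^ 3 ≤ η * (1 / 64) := by
    have : η * η ≤ 1 / 64 := by nlinarith
    have := mul_le_mul_of_nonneg_left this hη.le
    linarith
  linarith

theorem one_le_log_four_mul_div {k : ℕ} {δ : ℝ} (hk : 1 ≤ k) (hδ : 0 < δ) (hδ1 : δ < 1) :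
    1 ≤ Real.log (4 * k / δ) := by
  have hk' : (1 : ℝ) ≤ k := by exact_mod_cast hk
  rw [Real.le_log_iff_exp_le (by positivity)]
  refine Real.exp_one_lt_d9.le.trans ?_
  rw [le_div_iff₀ hδ]
  linarith

theorem two_le_numRounds {k : ℕ} {α δ : ℝ} (hk : 1 ≤ k) (hδ : 0 < δ) (hδ1 : δ < 1) (hα : 0 < α) :
    2 ≤ numRounds k α δ := by
  have := one_le_log_four_mul_div hk hδ hδ1
  have : 0 < ⌈Real.log (4 * k / δ) / (α / 40) ^ 3⌉₊ := Nat.ceil_pos.2 (by positivity)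
  unfold numRounds
  omega

/-- The majority vote returned by Algorithm NR2 is accurate for all players with high
probability. -/
theorem nr2_accuracy {d : ℕ} {ε δ α : ℝ} (hk : 1 ≤ k) (hε : 0 < ε) (hδ : 0 < δ)
    (hδ1 : δ < 1) (hεα : 5 * ε / 4 < α) (hα1 : α < 1) (hF : ∀ f ∈ F, Measurable f)
    (hd : vcDim F = d) (hO : IsOracle F (ε / 64) O) (D : Fin k → Measure (X × Bool))
    [∀ i, IsProbabilityMeasure (D i)] :
    1 - δ ≤ (nr2Law 4 1 d ε δ α O D).real
      {h | ∀ i, err (D i) (nr2Output O h) ≤ (2 + α) * OPT F D + ε} := by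
  set a := α / 40 with ha
  set e := ε / 64 with he
  set t := numRounds k α δ with ht
  set m := trainSize 4 k d ε δ α with hm
  set n := testSize 1 ε α with hn
  have hα : 0 < α := by linarith
  have ha0 : 0 < a := by positivity
  have he0 : 0 < e := by positivity
  have ha1 : a ≤ 1 / 40 := by rw [ha]; linarith
  -- Divided by `40`, the hypothesis `5ε/4 < α` reads `ε/32 < a`, and `ε/32` is exactly `2 * e`.
  have hea : 2 * e ≤ a := by rw [ha, he]; linarith
  have he1 : e ≤ 1 / 64 := by rw [he]; linarith
  have ht2 : 2 ≤ t := two_le_numRounds hk hδ hδ1 hα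
  have ht2' : (2 : ℝ) ≤ t := by exact_mod_cast ht2
  have hk' : (1 : ℝ) ≤ k := by exact_mod_cast hk
  have hη : 0 < δ / (4 * t) := by positivity
  have hη1 : δ / (4 * t) ≤ 1 / 8 := by
    rw [div_le_div_iff₀ (by positivity) (by norm_num)]
    linarith
  obtain ⟨hm2, hfail⟩ := train_failure_le (d := d) (m := m) ha0 hea he0 he1 hη hη1
    (Nat.le_ceil _)
  have hn1 : 1 ≤ a * e * n := by
    have h1 : 1 / (a * e) * Real.log (1 / a) ≤ n := Nat.le_ceil _
    have h2 : 1 ≤ Real.log (1 / a) := by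
      rw [Real.le_log_iff_exp_le (by positivity)]
      refine Real.exp_one_lt_d9.le.trans ?_
      rw [le_div_iff₀ ha0]
      linarith
    have h3 := mul_le_mul_of_nonneg_left h1 (mul_pos ha0 he0).le
    have h4 : a * e * (1 / (a * e) * Real.log (1 / a)) = Real.log (1 / a) := by field_simp
    linarith
  -- The answer to the empty sample witnesses that `F` is nonempty. One `f` serves all rounds, since
  -- being near-optimal for every player it is so for every mixture.
  obtain ⟨f, hfF, hf⟩ := exists_err_le_OPT_add ⟨_, hO.mem 0 Fin.elim0⟩ D he0
  have hprob : IsProbabilityMeasure (nr2Law 4 1 d ε δ α O D) :=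
    isProbabilityMeasure_runLaw hO hk ha0 he0 m n D t
  have hbad := runLaw_compl_le hO hk ha0 (by linarith) he0 (P := OPT F D) (m := m) (n := n) hn1 D
    (r := t) hδ fun w hw => by
      have := isProbabilityMeasure_mixture hk D hw
      exact (hO.pi_not_trainGood_le hd.le (mixture D w) ha0 (by linarith) he0 (by linarith) hm2
        hfF (hF f hfF) (err_mixture_le hk D hw hf)).trans (ENNReal.ofReal_le_ofReal hfail)
  set good := {h : Fin t → Round X k m n | RunGood O a e (OPT F D) D t h ∧
      ∑ i, weight O a e h i ≤ 4 * k / δ * (1 + a ^ 2) ^ t ∧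
      ∀ i, gainRatio O a e D h i ≤ 4 * k / δ}
  have hlog : 2 * Real.log (4 * k / δ) ≤ a ^ 3 * t := by
    have h1 : Real.log (4 * k / δ) / a ^ 3 ≤ ⌈Real.log (4 * k / δ) / (α / 40) ^ 3⌉₊ :=
      Nat.le_ceil _
    rw [div_le_iff₀ (by positivity)] at h1
    rw [ht, numRounds]
    push_cast
    linarith
  have hsub : good ⊆ {h | ∀ i, err (D i) (nr2Output O h) ≤ (2 + α) * OPT F D + ε} := by
    rintro h ⟨h1, h2, h3⟩ i
    have h4 := h1.err_maj_le hO ha0 ha1 he0 (OPT_nonneg F D) D (by omega) (by positivity) hlog h2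
      (h3 i)
    refine h4.trans (le_of_eq ?_)
    rw [ha, he]
    ring
  have h1 : (1 : ENNReal) ≤ nr2Law 4 1 d ε δ α O D
      {h | ∀ i, err (D i) (nr2Output O h) ≤ (2 + α) * OPT F D + ε} + ENNReal.ofReal δ := by
    rw [← measure_univ (μ := nr2Law 4 1 d ε δ α O D), ← Set.union_compl_self good]
    exact (measure_union_le _ _).trans (add_le_add (measure_mono hsub) hbad)
  have h2 := ENNReal.toReal_mono (by simp) h1
  rw [ENNReal.toReal_add (measure_ne_top _ _) ENNReal.ofReal_ne_top, ENNReal.toReal_one,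
    ENNReal.toReal_ofReal hδ.le] at h2
  rw [measureReal_def]
  linarith

end Accuracy

/-! ### Sample complexity -/

section SampleCount

/-- The argument of the ceiling is at least `1`, so rounding at most doubles it: `256000 = 4 * 40 ^
3`. -/
theorem numRounds_le {k : ℕ} {α δ : ℝ} (hk : 1 ≤ k) (hδ : 0 < δ) (hδ1 : δ < 1) (hα : 0 < α)
    (hα1 : α < 1) : (numRounds k α δ : ℝ) ≤ 256000 * Real.log (4 * k / δ) / α ^ 3 := by
  have h1 := one_le_log_four_mul_div hk hδ hδ1
  have h2 : α ^ 3 ≤ 1 := pow_le_one₀ hα.le hα1.le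
  have h3 := (Nat.ceil_lt_add_one (a := Real.log (4 * k / δ) / (α / 40) ^ 3) (by positivity)).le
  have h4 : (1 : ℝ) ≤ Real.log (4 * k / δ) / (α / 40) ^ 3 := by
    rw [le_div_iff₀ (by positivity), div_pow]
    norm_num
    linarith
  have h5 : Real.log (4 * k / δ) / (α / 40) ^ 3 = 64000 * Real.log (4 * k / δ) / α ^ 3 := by
    field_simp
    norm_num
  unfold numRounds
  push_cast
  rw [h5] at h3 h4 ⊢
  calc _ ≤ 4 * (64000 * Real.log (4 * k / δ) / α ^ 3) := by linarith
    _ = _ := by ring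

theorem half_le_log_two_div {α : ℝ} (hα : 0 < α) (hα1 : α < 1) :
    Real.log 2 ≤ Real.log (2 / α) ∧ 1 / 2 ≤ Real.log (2 / α) := by
  have h1 : Real.log 2 ≤ Real.log (2 / α) :=
    Real.log_le_log (by norm_num) (by rw [le_div_iff₀ hα]; linarith)
  exact ⟨h1, by linarith [Real.log_two_gt_d9]⟩

/-- The number of rounds is polynomial in `k`, `1/δ` and `1/α` (using `log x ≤ x`), so its logarithm
is absorbed without touching the `d` term: `27 = 22 + 2 + 3`, from `2 ^ 22`, `k` and `(1/α) ^ 3`. -/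
theorem log_numRounds_le {k : ℕ} {α δ : ℝ} (hk : 1 ≤ k) (hδ : 0 < δ) (hδ1 : δ < 1) (hα : 0 < α)
    (hα1 : α < 1) : Real.log (1 / (δ / (4 * numRounds k α δ))) ≤
      27 * (k * Real.log (2 / α)) + 2 * Real.log (1 / δ) := by
  have hk' : (1 : ℝ) ≤ k := by exact_mod_cast hk
  have hk0 : (0 : ℝ) < k := by linarith
  have ht0 : (0 : ℝ) < numRounds k α δ := by
    exact_mod_cast (two_le_numRounds hk hδ hδ1 hα).trans_lt' two_pos
  obtain ⟨h1, h2⟩ := half_le_log_two_div hα hα1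
  have h3 : 1 / (δ / (4 * numRounds k α δ)) ≤ 2 ^ 22 * k * (1 / δ) ^ 2 * (1 / α) ^ 3 := by
    have h4 : Real.log (4 * k / δ) ≤ 4 * k / δ := by
      linarith [Real.log_le_sub_one_of_pos (show 0 < 4 * k / δ by positivity)]
    have h5 : (numRounds k α δ : ℝ) ≤ 256000 * (4 * k / δ) / α ^ 3 :=
      (numRounds_le hk hδ hδ1 hα hα1).trans (by gcongr)
    calc 1 / (δ / (4 * numRounds k α δ)) = 4 / δ * numRounds k α δ := by field_simp
      _ ≤ 4 / δ * (256000 * (4 * k / δ) / α ^ 3) := by gcongr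
      _ = 4096000 * (k * (1 / δ) ^ 2 * (1 / α) ^ 3) := by ring
      _ ≤ 2 ^ 22 * (k * (1 / δ) ^ 2 * (1 / α) ^ 3) := by gcongr; norm_num
      _ = _ := by ring
  refine (Real.log_le_log (by positivity) h3).trans ?_
  rw [Real.log_mul (by positivity) (by positivity), Real.log_mul (by positivity) (by positivity),
    Real.log_mul (by positivity) (by positivity), Real.log_pow, Real.log_pow, Real.log_pow]
  push_cast
  have h6 : Real.log k ≤ 2 * (k * Real.log (2 / α)) := by
    have := Real.log_le_sub_one_of_pos hk0
    have := mul_le_mul_of_nonneg_left h2 hk0.le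
    linarith
  have h7 : Real.log (2 / α) ≤ k * Real.log (2 / α) := by nlinarith
  have h8 : Real.log (1 / α) ≤ Real.log (2 / α) :=
    Real.log_le_log (by positivity) (by gcongr; norm_num)
  linarith

/-- As `ε < 4/5`, `log (1/ε)` is bounded away from `0` and absorbs `log 64`; numerically `64 ≤ (5/4)
^ 19`. -/
theorem log_sixtyFour_div_le {ε : ℝ} (hε : 0 < ε) (hε1 : 5 * ε / 4 < 1) :
    Real.log (1 / (ε / 64)) ≤ 20 * Real.log (1 / ε) := by
  have h1 : Real.log (5 / 4) ≤ Real.log (1 / ε) :=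
    Real.log_le_log (by norm_num) (by rw [le_div_iff₀ hε]; linarith)
  have h2 : Real.log 64 ≤ 19 * Real.log (5 / 4) := by
    rw [show (19 : ℝ) = (19 : ℕ) by norm_num, ← Real.log_pow]
    exact Real.log_le_log (by norm_num) (by norm_num)
  rw [one_div_div, div_eq_mul_one_div, Real.log_mul (by norm_num) (by positivity)]
  linarith

theorem nr2SampleCount_le {k d : ℕ} {ε δ α : ℝ} (hk : 1 ≤ k) (hε : 0 < ε) (hδ : 0 < δ)
    (hδ1 : δ < 1) (hεα : 5 * ε / 4 < α) (hα1 : α < 1) :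
    (nr2SampleCount 4 1 k d ε δ α : ℝ) ≤ 154664960000 * (1 / (α ^ 4 * ε) * Real.log (2 * k / δ) *
      (d * Real.log (1 / ε) + k * Real.log (2 / α) + Real.log (1 / δ))) := by
  have hα : 0 < α := by linarith
  have hk' : (1 : ℝ) ≤ k := by exact_mod_cast hk
  have hk0 : (0 : ℝ) < k := by linarith
  obtain ⟨hl2, hl2'⟩ := half_le_log_two_div hα hα1
  set A := d * Real.log (1 / ε) + k * Real.log (2 / α) + Real.log (1 / δ) with hA
  set V := 1 / (α / 40 * (ε / 64)) with hV
  have hV1 : 1 ≤ V := by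
    rw [hV, le_div_iff₀ (by positivity)]
    nlinarith
  have hlε : 0 ≤ d * Real.log (1 / ε) :=
    mul_nonneg (by positivity) (Real.log_nonneg (by rw [le_div_iff₀ hε]; linarith))
  have hlδ : 0 ≤ Real.log (1 / δ) := Real.log_nonneg (by rw [le_div_iff₀ hδ]; linarith)
  have hkl : (k : ℝ) * (1 / 2) ≤ k * Real.log (2 / α) := mul_le_mul_of_nonneg_left hl2' hk0.le
  have hA0 : 1 / 2 ≤ A := by linarith
  have hVA : k * Real.log (2 / α) ≤ V * (k * Real.log (2 / α)) :=
    le_mul_of_one_le_left (by linarith) hV1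
  have hVA' : A ≤ V * A := le_mul_of_one_le_left (by linarith) hV1
  have htrain : (trainSize 4 k d ε δ α : ℝ) ≤ 110 * (V * A) := by
    have h1 : 0 ≤ d * Real.log (1 / (ε / 64)) + Real.log (1 / (δ / (4 * numRounds k α δ))) := by
      have ht : (2 : ℝ) ≤ numRounds k α δ := by exact_mod_cast two_le_numRounds hk hδ hδ1 hα
      refine add_nonneg (mul_nonneg (by positivity) (Real.log_nonneg ?_)) (Real.log_nonneg ?_)
      · rw [le_div_iff₀ (by positivity)]; linarith
      · rw [le_div_iff₀ (by positivity), one_mul, div_le_one (by positivity)]; linarith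
    have h2 : d * Real.log (1 / (ε / 64)) ≤ d * (20 * Real.log (1 / ε)) :=
      mul_le_mul_of_nonneg_left (log_sixtyFour_div_le hε (by linarith)) (by positivity)
    have h3 := log_numRounds_le hk hδ hδ1 hα hα1
    have h4 : d * Real.log (1 / (ε / 64)) + Real.log (1 / (δ / (4 * numRounds k α δ))) ≤ 27 * A := by
      linarith
    refine (Nat.ceil_lt_add_one (mul_nonneg (by positivity) h1)).le.trans ?_
    rw [show 4 / (α / 40 * (ε / 64)) = 4 * V by rw [hV]; ring]
    have h5 := mul_le_mul_of_nonneg_left h4 (by positivity : 0 ≤ 4 * V)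
    linarith
  have htest : (k : ℝ) * testSize 1 ε α ≤ 8 * (V * A) := by
    have h1 : Real.log (1 / (α / 40)) ≤ 6 * Real.log (2 / α) := by
      have h2 : Real.log 20 ≤ 5 * Real.log 2 := by
        rw [show (5 : ℝ) = (5 : ℕ) by norm_num, ← Real.log_pow]
        exact Real.log_le_log (by norm_num) (by norm_num)
      rw [one_div_div, show (40 : ℝ) / α = 20 * (2 / α) by ring,
        Real.log_mul (by norm_num) (by positivity)]
      linarith
    have h2 : 0 ≤ Real.log (1 / (α / 40)) :=
      Real.log_nonneg (by rw [le_div_iff₀ (by positivity)]; linarith)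
    have h3 : (testSize 1 ε α : ℝ) ≤ V * (6 * Real.log (2 / α)) + 1 := by
      refine (Nat.ceil_lt_add_one (mul_nonneg (by positivity) h2)).le.trans ?_
      gcongr
    have h4 := mul_le_mul_of_nonneg_left h3 hk0.le
    have h5 : V * (k * Real.log (2 / α)) ≤ V * A :=
      mul_le_mul_of_nonneg_left (by linarith) (by linarith)
    linarith
  have hrounds : (numRounds k α δ : ℝ) ≤ 512000 * Real.log (2 * k / δ) / α ^ 3 := by
    have h1 : Real.log 2 ≤ Real.log (2 * k / δ) :=
      Real.log_le_log (by norm_num) (by rw [le_div_iff₀ hδ]; linarith)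
    have h2 : Real.log (4 * k / δ) = Real.log 2 + Real.log (2 * k / δ) := by
      rw [← Real.log_mul (by norm_num) (by positivity)]
      congr 1
      ring
    refine (numRounds_le hk hδ hδ1 hα hα1).trans ?_
    exact div_le_div_of_nonneg_right (by linarith) (by positivity)
  unfold nr2SampleCount
  push_cast
  -- `118 = 110 + 8`: the training part is `4 * 27`, the test part `6`, and each ceiling costs at
  -- most `2 * (V * A)`. The factor `40 * 64 = 2560` in `V` completes the constant.
  calc _ ≤ 512000 * Real.log (2 * k / δ) / α ^ 3 * (118 * (V * A)) := by
        refine mul_le_mul hrounds (by linarith) (by positivity) ((Nat.cast_nonneg _).trans hrounds)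
    _ = _ := by
        rw [hV]
        field_simp
        ring

/-- The two extra hypotheses say `log 2 ≤ log (1/α)` and `log 2 ≤ log (k/δ)`. Removing the `2`
inside each logarithm thus costs a factor of at most `2`. -/
theorem sampleBound_le_of_le_half {k d : ℕ} {ε δ α : ℝ} (hk : 1 ≤ k) (hε : 0 < ε) (hδ : 0 < δ)
    (hδ1 : δ < 1) (hεα : 5 * ε / 4 < α) (hα : α ≤ 1 / 2) (hδk : 2 * δ ≤ k) :
    1 / (α ^ 4 * ε) * Real.log (2 * k / δ) *
      (d * Real.log (1 / ε) + k * Real.log (2 / α) + Real.log (1 / δ)) ≤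
    4 * (1 / (α ^ 4 * ε) * Real.log (k / δ) *
      (d * Real.log (1 / ε) + k * Real.log (1 / α) + Real.log (1 / δ))) := by
  have hα0 : 0 < α := by linarith
  have hk' : (1 : ℝ) ≤ k := by exact_mod_cast hk
  have hlε : 0 ≤ d * Real.log (1 / ε) :=
    mul_nonneg (by positivity) (Real.log_nonneg (by rw [le_div_iff₀ hε]; linarith))
  have hlδ : 0 ≤ Real.log (1 / δ) := Real.log_nonneg (by rw [le_div_iff₀ hδ]; linarith)
  have h2 : 0 ≤ Real.log 2 := Real.log_nonneg (by norm_num)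
  have h1 : Real.log (2 * k / δ) ≤ 2 * Real.log (k / δ) := by
    have h3 : Real.log 2 ≤ Real.log (k / δ) :=
      Real.log_le_log (by norm_num) (by rw [le_div_iff₀ hδ]; linarith)
    rw [mul_div_assoc, Real.log_mul (by norm_num) (by positivity)]
    linarith
  have h3 : Real.log (2 / α) ≤ 2 * Real.log (1 / α) := by
    have h4 : Real.log 2 ≤ Real.log (1 / α) :=
      Real.log_le_log (by norm_num) (by rw [le_div_iff₀ hα0]; linarith)
    rw [div_eq_mul_one_div, Real.log_mul (by norm_num) (by positivity)]
    linarith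
  have h4 : 0 ≤ Real.log (2 / α) := Real.log_nonneg (by rw [le_div_iff₀ hα0]; linarith)
  have h5 : d * Real.log (1 / ε) + k * Real.log (2 / α) + Real.log (1 / δ) ≤
      2 * (d * Real.log (1 / ε) + k * Real.log (1 / α) + Real.log (1 / δ)) := by
    have := mul_le_mul_of_nonneg_left h3 (by linarith : (0 : ℝ) ≤ k)
    linarith
  have h6 : 0 ≤ Real.log (k / δ) := Real.log_nonneg (by rw [le_div_iff₀ hδ]; linarith)
  have h7 : 0 ≤ d * Real.log (1 / ε) + k * Real.log (2 / α) + Real.log (1 / δ) := by positivity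
  calc _ ≤ 1 / (α ^ 4 * ε) * (2 * Real.log (k / δ)) *
        (2 * (d * Real.log (1 / ε) + k * Real.log (1 / α) + Real.log (1 / δ))) := by gcongr
    _ = _ := by ring

end SampleCount

end CollabPAC

end

open MeasureTheory CollabPAC in
theorem theorem4 :
    ∃ C₁ > (0 : ℝ), ∃ C₂ > (0 : ℝ), ∃ C > (0 : ℝ),
      ∀ (k d : ℕ) (ε δ α : ℝ), 1 ≤ k → 0 < ε → ε < 1 → 0 < δ → δ < 1 →
        5 * ε / 4 < α → α < 1 →
        (∀ (X : Type*) [MeasurableSpace X] (F : Set (X → Bool))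
          (O : (n : ℕ) → (Fin n → X × Bool) → X → Bool)
          (D : Fin k → Measure (X × Bool)) [∀ i, IsProbabilityMeasure (D i)],
          (∀ f ∈ F, Measurable f) → vcDim F = d → IsOracle F (ε / 64) O →
          1 - δ ≤ (nr2Law C₁ C₂ d ε δ α O D).real
            {h | ∀ i, err (D i) (nr2Output O h) ≤ (2 + α) * OPT F D + ε}) ∧
        (nr2SampleCount C₁ C₂ k d ε δ α : ℝ) ≤
          C * (1 / (α ^ 4 * ε) * Real.log (2 * k / δ) *
            (d * Real.log (1 / ε) + k * Real.log (2 / α) + Real.log (1 / δ))) ∧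
        (α ≤ 1 / 2 → 2 * δ ≤ k →
          (nr2SampleCount C₁ C₂ k d ε δ α : ℝ) ≤
            C * (1 / (α ^ 4 * ε) * Real.log (k / δ) *
              (d * Real.log (1 / ε) + k * Real.log (1 / α) + Real.log (1 / δ)))) := by
  -- `C₁ = 4` is what `train_failure_le` needs; `C₂ = 1` suffices because the test samples only
  -- require `a * e * n ≥ 1`. The `4` in `C` pays for the second form of the bound.
  refine ⟨4, by norm_num, 1, by norm_num, 4 * 154664960000, by norm_num, ?_⟩
  intro k d ε δ α hk hε _ hδ hδ1 hεα hα1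
  have hcount := nr2SampleCount_le (d := d) hk hε hδ hδ1 hεα hα1
  refine ⟨?_, ?_, fun hα hδk => ?_⟩
  · intro X _ F O D _ hF hd hO
    exact nr2_accuracy hk hε hδ hδ1 hεα hα1 hF hd hO D
  · have : (0 : ℝ) ≤ nr2SampleCount 4 1 k d ε δ α := Nat.cast_nonneg _
    linarith
  · have := sampleBound_le_of_le_half (d := d) hk hε hδ hδ1 hεα hα hδk
    linarith
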